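/- Let $\mathbb{X}$ be a complete separable metric space with Borel $\sigma$-algebra $\mathcal{X}$, let $\nu$ be a probability measure on $\mathbb{X}$, let $\theta>0$, and let $R$ be a finite transition kernel on $\mathbb{X}$ (each $R_x$ is a finite measure on $\mathcal{X}$, and $x\mapsto R_x(B)$ is measurable for every $B\in\mathcal{X}$) with $R_x(\mathbb{X})>0$ for $\nu$-a.e. $x$. Let $(X_n)_{n\ge1}$ be a measure-valued Pólya urn sequence MVPS$(\theta,\nu,R)$, that is, a sequence of $\mathbb{X}$-valued random variables on a probability space $(\Omega,\mathcal{H},\mathbb{P})$ such that $X_1\sim\nu$ and, for all $n\ge1$, \[\mathbb{P}(X_{n+1}\in\cdot\mid X_1,\ldots,X_n)=\frac{\theta\,\nu(\cdot)+\sum_{i=1}^n R_{X_i}(\cdot)}{\theta+\sum_{i=1}^n R_{X_i}(\mathbb{X})}\qquad\text{a.s.}\] Suppose that $(X_n)_{n\ge1}$ is exchangeable, i.e. for every $n$ the law of $(X_1,\ldots,X_n)$ is invariant under all permutations of the indices. Then there exists a sub-$\sigma$-algebra $\mathcal{G}$ of $\mathcal{X}$ such that, for $\nu$-a.e. $x$,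 \[\frac{R_x(\cdot)}{R_x(\mathbb{X})}=\nu(\cdot\mid\mathcal{G})(x),\] where $\nu(\cdot\mid\mathcal{G})$ denotes a regular version of the conditional distribution of $\nu$ given $\mathcal{G}$. Moreover, $\mathcal{G}$ is countably generated under $\nu$: there is $C\in\mathcal{G}$ with $\nu(C)=1$ such that the trace $\sigma$-algebra $\mathcal{G}\cap C=\{A\cap C:A\in\mathcal{G}\}$ on $C$ is countably generated. Consequently $\nu(\cdot\mid\mathcal{G})$ is a.e. proper: there is $F\in\mathcal{X}$ with $\nu(F)=1$ such that $\nu(A\mid\mathcal{G})(x)=\delta_x(A)$ for all $A\in\mathcal{G}$ and all $x\in F$. -/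

import Mathlib

open MeasureTheory ProbabilityTheory

/-- The sequence `X 0, X 1, X 2, …` is exchangeable under `P`: for every
`n`, the law of the first `n` terms is invariant under all permutations of the indices. -/
def IsExchangeable {Ω 𝕏 : Type*} [MeasurableSpace Ω] [MeasurableSpace 𝕏]
    (P : Measure Ω) (X : ℕ → Ω → 𝕏) : Prop :=
  ∀ (n : ℕ) (σ : Equiv.Perm (Fin n)),
    P.map (fun ω (i : Fin n) => X (σ i) ω) = P.map (fun ω (i : Fin n) => X i ω)

/-- `X 0, X 1, …` is a measure-valued Pólya urn sequence with initial mass `θ`, base measure `ν` and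
reinforcement kernel `R`: `X 0` has law `ν` and, for every `n ≥ 1`, the conditional distribution of
`X n` given the `σ`-algebra generated by `X 0, …, X (n - 1)` is
`(θ ν + ∑ i < n, R (X i)) / (θ + ∑ i < n, R (X i) 𝕏)`. -/
structure IsMVPS {Ω 𝕏 : Type*} [MeasurableSpace Ω] [MeasurableSpace 𝕏]
    (P : Measure Ω) (X : ℕ → Ω → 𝕏) (θ : ℝ) (ν : Measure 𝕏) (R : Kernel 𝕏 𝕏) : Prop where
  measurable : ∀ n, Measurable (X n)
  map_zero : P.map (X 0) = ν
  predictive : ∀ n : ℕ, 1 ≤ n → ∀ B : Set 𝕏, MeasurableSet B →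
    P⟦X n ⁻¹' B | MeasurableSpace.comap (fun ω (i : Fin n) => X i ω) inferInstance⟧ =ᵐ[P]
      fun ω => (θ * ν.real B + ∑ i : Fin n, (R (X i ω)).real B) /
        (θ + ∑ i : Fin n, (R (X i ω)).real Set.univ)

/-- A sub-`σ`-algebra `𝒢` is countably generated under `ν`: there is `C ∈ 𝒢` with `ν C = 1` such that
the trace `𝒢 ∩ C`, a `σ`-algebra on `C`, is countably generated. -/
def IsCountablyGeneratedUnder {𝕏 : Type*} [m𝕏 : MeasurableSpace 𝕏]
    (ν : Measure[m𝕏] 𝕏) (𝒢 : MeasurableSpace 𝕏) : Prop :=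
  ∃ C : Set 𝕏, MeasurableSet[𝒢] C ∧ ν C = 1 ∧
    @MeasurableSpace.CountablyGenerated C (MeasurableSpace.comap (Subtype.val : C → 𝕏) 𝒢)

/-- A family `κ` of measures is `ν`-a.e. proper with respect to `𝒢`: there is a measurable `F` with
`ν F = 1` such that `κ x A = δ_x A` for all `A ∈ 𝒢` and `x ∈ F`. -/
def IsAEProper {𝕏 : Type*} [m𝕏 : MeasurableSpace 𝕏]
    (ν : Measure[m𝕏] 𝕏) (κ : 𝕏 → Measure[m𝕏] 𝕏) (𝒢 : MeasurableSpace 𝕏) : Prop :=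
  ∃ F : Set 𝕏, MeasurableSet[m𝕏] F ∧ ν F = 1 ∧
    ∀ A : Set 𝕏, MeasurableSet[𝒢] A → ∀ x ∈ F, κ x A = @Measure.dirac 𝕏 m𝕏 x A

open scoped NNReal

/-! Write `R x = θ f(x) K x` with `K` Markov. It suffices that `K` is reversible for `ν` and
idempotent (`K ∘ₘ K x = K x` a.e.). Then `y ↦ K y B` is constant under `K x`, so `K x` lives on the
fibre through `x` of `ρ = (K · (B n))ₙ`, with `(B n)` a countable generating π-system. Reversibility
then makes `K` the conditional distribution given `σ(ρ)`, which is countably generated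
(`exists_sigmaAlgebra_of_reversible_idempotent`).

Exchanging draws `n` and `n + 1` shows that, for almost every history, the law of the next two draws
is symmetric. Cleared of denominators through `q = f / (1 + f)`, this symmetry becomes
`UrnIdentity`, whose terms have degree at most two in the composition `μ`. It is used after zero,
one and two draws, that is for `μ = ν`, `ν + f(z) K z` and `ν + f(z) K z + f(z') K z'`.

If `q` is a.e. constant, zero draws give reversibility and one draw gives idempotence
(`reversible_idempotent_of_ae_const`). Otherwise the second difference in `μ` gives `PairIdentity`,
which relates `K z` and `K z'` for independent `z, z'`. A covariance argument on two sets where `q`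
takes disjoint values, followed by a bootstrap, forces `K z = ν` a.e.
(`PairIdentity.ae_eq_of_separating`), and both properties are then immediate. -/

/-! ### Reversible idempotent kernels are conditional distributions. -/

theorem MeasurableSpace.exists_seq_isPiSystem_generateFrom (α : Type*) [m : MeasurableSpace α]
    [MeasurableSpace.CountablyGenerated α] :
    ∃ B : ℕ → Set α, (∀ n, MeasurableSet (B n)) ∧ IsPiSystem (Set.range B) ∧
      m = MeasurableSpace.generateFrom (Set.range B) := by
  have hc := countable_generateSetAlgebra
    (MeasurableSpace.countable_countableGeneratingSet (α := α))
  obtain ⟨B, hB⟩ := hc.exists_eq_range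
    ⟨∅, self_subset_generateSetAlgebra MeasurableSpace.empty_mem_countableGeneratingSet⟩
  have hgen : m = MeasurableSpace.generateFrom (Set.range B) := by
    rw [← hB, generateFrom_generateSetAlgebra_eq,
      MeasurableSpace.generateFrom_countableGeneratingSet]
  refine ⟨B, fun n => ?_, ?_, hgen⟩
  · rw [hgen]
    exact MeasurableSpace.measurableSet_generateFrom ⟨n, rfl⟩
  · rw [← hB]
    exact isSetAlgebra_generateSetAlgebra.isSetRing.isSetSemiring.isPiSystem

/-- If `κ` is reversible with respect to `ν` and idempotent, then the value `κ x B` is preserved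
by a transition of `κ`. -/
theorem ae_ae_measure_eq_of_reversible_idempotent {𝕏 : Type*} [MeasurableSpace 𝕏]
    {ν : Measure 𝕏} [IsProbabilityMeasure ν] {κ : Kernel 𝕏 𝕏} [IsMarkovKernel κ]
    (hrev : (ν ⊗ₘ κ).map Prod.swap = ν ⊗ₘ κ) (hidem : ∀ᵐ x ∂ν, κ ∘ₘ (κ x) = κ x)
    {B : Set 𝕏} (hB : MeasurableSet B) :
    ∀ᵐ x ∂ν, ∀ᵐ y ∂(κ x), κ y B = κ x B := by
  have hu : Measurable fun x => (κ x).real B := (κ.measurable_coe hB).ennreal_toReal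
  have hu0 : ∀ x, 0 ≤ (κ x).real B := fun x => measureReal_nonneg
  have hu1 : ∀ x, (κ x).real B ≤ 1 := fun x => measureReal_le_one
  have hbd : ∀ g : 𝕏 × 𝕏 → ℝ, Measurable g → (∀ z, |g z| ≤ 1) → Integrable g (ν ⊗ₘ κ) :=
    fun g hg h1 => Integrable.of_bound hg.aestronglyMeasurable 1 (.of_forall h1)
  have hsq : ∀ a b : ℝ, 0 ≤ a → a ≤ 1 → 0 ≤ b → b ≤ 1 → |a * b| ≤ 1 := fun a b h1 h2 h3 h4 => by
    rw [abs_of_nonneg (mul_nonneg h1 h3)]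
    exact mul_le_one₀ h2 h3 h4
  have hfst : Integrable (fun z : 𝕏 × 𝕏 => (κ z.1).real B * (κ z.1).real B) (ν ⊗ₘ κ) :=
    hbd _ ((hu.comp measurable_fst).mul (hu.comp measurable_fst)) fun z => hsq _ _ (hu0 _) (hu1 _) (hu0 _) (hu1 _)
  have hsnd : Integrable (fun z : 𝕏 × 𝕏 => (κ z.2).real B * (κ z.2).real B) (ν ⊗ₘ κ) :=
    hbd _ ((hu.comp measurable_snd).mul (hu.comp measurable_snd)) fun z => hsq _ _ (hu0 _) (hu1 _) (hu0 _) (hu1 _)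
  have hmix : Integrable (fun z : 𝕏 × 𝕏 => (κ z.1).real B * (κ z.2).real B) (ν ⊗ₘ κ) :=
    hbd _ ((hu.comp measurable_fst).mul (hu.comp measurable_snd)) fun z => hsq _ _ (hu0 _) (hu1 _) (hu0 _) (hu1 _)
  have hswap : ∫ z, (κ z.2).real B * (κ z.2).real B ∂(ν ⊗ₘ κ)
      = ∫ z, (κ z.1).real B * (κ z.1).real B ∂(ν ⊗ₘ κ) := by
    conv_rhs => rw [← hrev]
    exact (integral_map measurable_swap.aemeasurable
      ((hu.comp measurable_fst).mul (hu.comp measurable_fst)).aestronglyMeasurable).symm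
  have hmix' : ∫ z, (κ z.1).real B * (κ z.2).real B ∂(ν ⊗ₘ κ)
      = ∫ z, (κ z.1).real B * (κ z.1).real B ∂(ν ⊗ₘ κ) := by
    rw [Measure.integral_compProd hmix, Measure.integral_compProd hfst]
    refine integral_congr_ae ?_
    filter_upwards [hidem] with x hx
    have h1 : (κ x).real B = ∫ y, (κ y).real B ∂(κ x) := by
      conv_lhs => rw [← hx]
      rw [measureReal_def, Measure.bind_apply hB κ.aemeasurable,
        integral_eq_lintegral_of_nonneg_ae (.of_forall hu0) hu.aestronglyMeasurable]
      simp
    simp only [integral_const_mul, ← h1, integral_const, probReal_univ, one_smul]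
  -- The three second moments in the expanded square coincide: the two pure ones by reversibility,
  -- the mixed one by idempotence.
  have hzero : ∫ z, ((κ z.2).real B - (κ z.1).real B) ^ 2 ∂(ν ⊗ₘ κ) = 0 := by
    have : ∀ z : 𝕏 × 𝕏, ((κ z.2).real B - (κ z.1).real B) ^ 2
        = (κ z.2).real B * (κ z.2).real B + (κ z.1).real B * (κ z.1).real B
          - 2 * ((κ z.1).real B * (κ z.2).real B) := fun z => by ring
    simp_rw [this]
    have h1 := integral_sub (hsnd.add hfst) (hmix.const_mul 2)
    have h2 := integral_add hsnd hfst
    rw [integral_const_mul] at h1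
    simp only [Pi.add_apply] at h1 h2
    linarith
  have hint : Integrable (fun z : 𝕏 × 𝕏 => ((κ z.2).real B - (κ z.1).real B) ^ 2) (ν ⊗ₘ κ) :=
    hbd _ (((hu.comp measurable_snd).sub (hu.comp measurable_fst)).pow_const 2) fun z => by
      rw [abs_of_nonneg (sq_nonneg _), sq_le_one_iff_abs_le_one, abs_le]
      constructor <;> linarith [hu0 z.1, hu1 z.1, hu0 z.2, hu1 z.2]
  have hae := (integral_eq_zero_iff_of_nonneg (fun z => sq_nonneg _) hint).1 hzero
  filter_upwards [Measure.ae_ae_of_ae_compProd hae] with x hx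
  filter_upwards [hx] with y hy
  have : (κ y).real B = (κ x).real B := by
    simpa [sub_eq_zero] using hy
  exact (measureReal_eq_measureReal_iff).1 this

/-- Both kernels disintegrate the same measure over the restriction of `ν` to `𝒢`, and such a
disintegration is a.e. unique. -/
theorem ae_eq_condExpKernel {𝕏 : Type*} {𝒢 : MeasurableSpace 𝕏} [m𝕏 : MeasurableSpace 𝕏]
    [StandardBorelSpace 𝕏] (h𝒢 : 𝒢 ≤ m𝕏) {ν : Measure 𝕏} [IsFiniteMeasure ν]
    {κ : Kernel 𝕏 𝕏} [IsMarkovKernel κ] (hκ : Measurable[𝒢] fun x => κ x)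
    (h : ∀ A B, MeasurableSet[𝒢] A → MeasurableSet B → ∫⁻ x in A, κ x B ∂ν = ν (A ∩ B)) :
    ∀ᵐ x ∂ν, κ x = condExpKernel ν 𝒢 x := by
  let κ' : Kernel[𝒢, m𝕏] 𝕏 𝕏 := @Kernel.mk 𝕏 𝕏 𝒢 m𝕏 (fun x => κ x) hκ
  have hmk : IsMarkovKernel κ' := ⟨fun x => (inferInstance : IsProbabilityMeasure (κ x))⟩
  have hm : 𝒢 ⊓ m𝕏 = 𝒢 := inf_eq_left.2 h𝒢
  have hkey : (ν.trim h𝒢) ⊗ₘ κ' = (ν.trim h𝒢) ⊗ₘ (condExpKernel ν 𝒢) := by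
    rw [compProd_trim_condExpKernel h𝒢]
    refine Measure.ext_prod_iff.2 fun {A B} hA hB => ?_
    rw [Measure.compProd_apply_prod hA hB, restrict_trim h𝒢 _ hA,
      lintegral_trim h𝒢 (κ'.measurable_coe hB), Measure.map_apply _ (hA.prod hB)]
    · exact h A B hA hB
    · exact (measurable_id'' h𝒢).prodMk measurable_id
  exact ae_of_ae_trim h𝒢 (Kernel.ae_eq_of_compProd_eq hkey)

/-- Take for `𝒢` the σ-algebra generated by `κ` itself, through its values on a countable π-system.
Properness of `κ` comes first; the conditional expectation property follows from it by
reversibility. -/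
theorem exists_sigmaAlgebra_of_reversible_idempotent {𝕏 : Type*}
    [m𝕏 : MeasurableSpace 𝕏] [StandardBorelSpace 𝕏]
    (ν : Measure 𝕏) [IsProbabilityMeasure ν] (κ : Kernel 𝕏 𝕏) [IsMarkovKernel κ]
    (hrev : (ν ⊗ₘ κ).map Prod.swap = ν ⊗ₘ κ) (hidem : ∀ᵐ x ∂ν, κ ∘ₘ (κ x) = κ x) :
    ∃ 𝒢 : MeasurableSpace 𝕏, 𝒢 ≤ m𝕏 ∧
      (∀ᵐ x ∂ν, κ x = condExpKernel (mΩ := m𝕏) ν 𝒢 x) ∧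
      IsCountablyGeneratedUnder (m𝕏 := m𝕏) ν 𝒢 ∧
      IsAEProper (m𝕏 := m𝕏) ν (fun x => condExpKernel (mΩ := m𝕏) ν 𝒢 x) 𝒢 := by
  obtain ⟨B, hBm, hBpi, hBgen⟩ := MeasurableSpace.exists_seq_isPiSystem_generateFrom 𝕏
  let ρ : 𝕏 → ℕ → ENNReal := fun x n => κ x (B n)
  have hρ : Measurable ρ := measurable_pi_lambda _ fun n => κ.measurable_coe (hBm n)
  have h𝒢 : MeasurableSpace.comap ρ inferInstance ≤ m𝕏 := hρ.comap_le
  have hκ𝒢 : Measurable[MeasurableSpace.comap ρ inferInstance] (fun x => κ x) := by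
    have hp : ∀ x, IsProbabilityMeasure ((fun x => κ x) x) := fun x => inferInstance
    refine @Measurable.measure_of_isPiSystem_of_isProbabilityMeasure _ _ (_) _ _ hp _
      hBgen hBpi ?_
    rintro _ ⟨n, rfl⟩
    exact (measurable_pi_apply n).comp (comap_measurable ρ)
  have hproper : ∀ᵐ x ∂ν, ∀ A : Set 𝕏, MeasurableSet[MeasurableSpace.comap ρ inferInstance] A →
      κ x A = Measure.dirac x A := by
    filter_upwards [ae_all_iff.2 fun n =>
      ae_ae_measure_eq_of_reversible_idempotent hrev hidem (hBm n)] with x hx A hA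
    have hAm := h𝒢 _ hA
    obtain ⟨D, -, rfl⟩ := hA
    -- `κ x` is carried by the fibre of `ρ` through `x`, and each set of `𝒢` is a union of fibres.
    have hρx : ∀ᵐ y ∂(κ x), ρ y = ρ x := by
      filter_upwards [ae_all_iff.2 hx] with y hy
      exact funext hy
    rw [Measure.dirac_apply' _ hAm]
    by_cases hxD : ρ x ∈ D
    · rw [Set.indicator_of_mem (by exact hxD), Pi.one_apply, ← prob_compl_eq_zero_iff hAm]
      refine mem_ae_iff.1 ?_
      filter_upwards [hρx] with y hy
      simpa [hy] using hxD
    · rw [Set.indicator_of_notMem (by exact hxD)]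
      refine measure_eq_zero_iff_ae_notMem.2 ?_
      filter_upwards [hρx] with y hy
      simpa [hy] using hxD
  have hcond : ∀ᵐ x ∂ν, κ x =
      condExpKernel (mΩ := m𝕏) ν (MeasurableSpace.comap ρ inferInstance) x := by
    -- Reversibility turns the integral of `κ x C` over `A` into that of `κ x A` over `C`, and by
    -- properness `κ x A` is the indicator of `A`.
    refine ae_eq_condExpKernel h𝒢 hκ𝒢 fun A C hA hC => ?_
    have hAm := h𝒢 _ hA
    rw [← Measure.compProd_apply_prod hAm hC, ← hrev,
      Measure.map_apply measurable_swap (hAm.prod hC), Set.preimage_swap_prod,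
      Measure.compProd_apply_prod hC hAm, ← setLIntegral_one,
      ← Measure.restrict_restrict hAm, ← lintegral_indicator hAm]
    refine lintegral_congr_ae (ae_restrict_of_ae ?_)
    filter_upwards [hproper] with x hx
    rw [hx A hA, Measure.dirac_apply' _ hAm]
    rfl
  refine ⟨MeasurableSpace.comap ρ inferInstance, h𝒢, hcond,
    ⟨Set.univ, MeasurableSet.univ, measure_univ, ?_⟩, ?_⟩
  · exact @MeasurableSpace.CountablyGenerated.comap _ _ (_) (.comap ρ) _
  · obtain ⟨N, hN, hNm, hN0⟩ := exists_measurable_superset_of_null (ae_iff.1 (hproper.and hcond))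
    refine ⟨Nᶜ, hNm.compl, (prob_compl_eq_one_iff hNm).2 hN0, fun A hA x hx => ?_⟩
    have hx' := not_not.1 fun h => hx (hN h)
    beta_reduce
    rw [← hx'.2]
    exact hx'.1 A hA

/-! ### Normalisation of kernels. -/

namespace ProbabilityTheory.Kernel

variable {α β : Type*} [MeasurableSpace α] [MeasurableSpace β]

/-- The kernel `a ↦ κ a / κ a univ`. -/
noncomputable def normalize (κ : Kernel α β) : Kernel α β where
  toFun a := (κ a Set.univ)⁻¹ • κ a
  measurable' := Measure.measurable_of_measurable_coe _ fun s hs => by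
    simp only [Measure.smul_apply, smul_eq_mul]
    exact (κ.measurable_coe MeasurableSet.univ).inv.mul (κ.measurable_coe hs)

theorem normalize_apply (κ : Kernel α β) (a : α) : κ.normalize a = (κ a Set.univ)⁻¹ • κ a := rfl

theorem isMarkovKernel_normalize {κ : Kernel α β} (h0 : ∀ a, κ a Set.univ ≠ 0)
    (hfin : ∀ a, κ a Set.univ ≠ ⊤) : IsMarkovKernel κ.normalize := by
  refine ⟨fun a => ⟨?_⟩⟩
  rw [normalize_apply, Measure.smul_apply, smul_eq_mul, ENNReal.inv_mul_cancel (h0 a) (hfin a)]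

end ProbabilityTheory.Kernel

/-! ### Predictive laws of the urn and the symmetry of two successive draws. -/

section Urn

variable {Ω 𝕏 : Type*} [MeasurableSpace Ω] [MeasurableSpace 𝕏]

/-- The composition `θ ν + ∑ i, R (h i)` of the urn after the draws `h`. -/
noncomputable def urnKernel (θ : ℝ≥0) (ν : Measure 𝕏) (R : Kernel 𝕏 𝕏) (n : ℕ) :
    Kernel (Fin n → 𝕏) 𝕏 :=
  Kernel.const _ (θ • ν) + ∑ i, R.comap (fun h => h i) (measurable_pi_apply i)

theorem urnKernel_apply (θ : ℝ≥0) (ν : Measure 𝕏) (R : Kernel 𝕏 𝕏) (n : ℕ) (h : Fin n → 𝕏) :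
    urnKernel θ ν R n h = θ • ν + ∑ i, R (h i) := by
  simp [urnKernel, Kernel.comap_apply]

theorem urnKernel_snoc (θ : ℝ≥0) (ν : Measure 𝕏) (R : Kernel 𝕏 𝕏) (n : ℕ) (h : Fin n → 𝕏)
    (x : 𝕏) : urnKernel θ ν R (n + 1) (Fin.snoc h x) = urnKernel θ ν R n h + R x := by
  simp [urnKernel_apply, Fin.sum_univ_castSucc, add_assoc]

variable {θ : ℝ≥0} {ν : Measure 𝕏} {R : Kernel 𝕏 𝕏}

theorem urnKernel_univ_ne_zero [IsProbabilityMeasure ν] (hθ : 0 < θ) (n : ℕ) (h : Fin n → 𝕏) :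
    urnKernel θ ν R n h Set.univ ≠ 0 := by
  simp [urnKernel_apply, hθ.ne']

theorem isFiniteMeasure_urnKernel [IsProbabilityMeasure ν] (hR : ∀ x, IsFiniteMeasure (R x))
    (n : ℕ) (h : Fin n → 𝕏) : IsFiniteMeasure (urnKernel θ ν R n h) := by
  rw [urnKernel_apply]
  infer_instance

theorem isMarkovKernel_normalize_urnKernel [IsProbabilityMeasure ν] (hθ : 0 < θ)
    (hR : ∀ x, IsFiniteMeasure (R x)) (n : ℕ) : IsMarkovKernel (urnKernel θ ν R n).normalize := by
  refine Kernel.isMarkovKernel_normalize (urnKernel_univ_ne_zero hθ n) fun h => ?_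
  have := isFiniteMeasure_urnKernel (θ := θ) (ν := ν) hR n h
  exact measure_ne_top _ _

variable {P : Measure Ω} [IsProbabilityMeasure P] {X : ℕ → Ω → 𝕏}

theorem normalize_urnKernel_real [IsProbabilityMeasure ν] (hR : ∀ x, IsFiniteMeasure (R x))
    (n : ℕ) (h : Fin n → 𝕏) (B : Set 𝕏) :
    ((urnKernel θ ν R n).normalize h).real B = (θ * ν.real B + ∑ i, (R (h i)).real B) /
        (θ + ∑ i, (R (h i)).real Set.univ) := by
  have hr : ∀ B, (urnKernel θ ν R n h).real B = θ * ν.real B + ∑ i, (R (h i)).real B := by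
    intro B
    rw [urnKernel_apply, measureReal_add_apply, measureReal_nnreal_smul_apply]
    simp [measureReal_def, ENNReal.toReal_sum]
  rw [Kernel.normalize_apply, measureReal_ennreal_smul_apply, ENNReal.toReal_inv,
    ← measureReal_def, hr, hr]
  simp [div_eq_inv_mul]

theorem IsMVPS.condExp_ae_eq [IsProbabilityMeasure ν] (hθ : 0 < θ)
    (hR : ∀ x, IsFiniteMeasure (R x)) (hX : IsMVPS P X θ ν R) (n : ℕ) {B : Set 𝕏}
    (hB : MeasurableSet B) :
    P⟦X n ⁻¹' B | MeasurableSpace.comap (fun ω (i : Fin n) => X i ω) inferInstance⟧ =ᵐ[P]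
      fun ω => ((urnKernel θ ν R n).normalize (fun i : Fin n => X i ω)).real B := by
  simp_rw [normalize_urnKernel_real hR]
  -- With no draws the conditioning σ-algebra is trivial and the formula reduces to the law of `X
  -- 0`, so the predictive rule extends to `n = 0`.
  rcases Nat.eq_zero_or_pos n with rfl | hn
  · have : MeasurableSpace.comap (fun ω (i : Fin 0) => X i ω) inferInstance
        = (⊥ : MeasurableSpace Ω) := by
      rw [show (fun ω (i : Fin 0) => X i ω) = fun _ => default from
        funext fun _ => Subsingleton.elim _ _, MeasurableSpace.comap_const]
    rw [this, condExp_bot]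
    refine .of_forall fun ω => ?_
    have h1 := hX.map_zero ▸ map_measureReal_apply (μ := P) (hX.measurable 0) hB
    have : (θ : ℝ) ≠ 0 := by exact_mod_cast hθ.ne'
    simp [integral_indicator (hX.measurable 0 hB), h1, this]
  · exact hX.predictive n hn B hB

theorem IsMVPS.map_prodMk_eq_compProd [IsProbabilityMeasure ν] (hθ : 0 < θ)
    (hR : ∀ x, IsFiniteMeasure (R x)) (hX : IsMVPS P X θ ν R) (n : ℕ) :
    P.map (fun ω => ((fun i : Fin n => X i ω), X n ω)) =
      P.map (fun ω (i : Fin n) => X i ω) ⊗ₘ (urnKernel θ ν R n).normalize := by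
  have hmk := isMarkovKernel_normalize_urnKernel (ν := ν) hθ hR n
  have hH : Measurable fun ω (i : Fin n) => X i ω := measurable_pi_lambda _ fun i => hX.measurable i
  have hp := Measure.isProbabilityMeasure_map (μ := P) hH.aemeasurable
  have hp' := Measure.isProbabilityMeasure_map (μ := P) (hH.prodMk (hX.measurable n)).aemeasurable
  refine Measure.ext_prod fun {A B} hA hB => ?_
  rw [Measure.compProd_apply_prod hA hB, setLIntegral_map hA (Kernel.measurable_coe _ hB) hH,
    Measure.map_apply (hH.prodMk (hX.measurable n)) (hA.prod hB)]
  have hBm := hX.measurable n hB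
  have hset := setIntegral_condExp (μ := P) hH.comap_le
    (f := (X n ⁻¹' B).indicator fun _ => (1 : ℝ))
    ((integrable_const 1).indicator hBm) ⟨A, hA, rfl⟩
  rw [setIntegral_congr_ae (hH hA) ((hX.condExp_ae_eq hθ hR n hB).mono fun _ h _ => h),
    setIntegral_indicator hBm, setIntegral_one_eq_measureReal] at hset
  rw [← ENNReal.toReal_eq_toReal_iff' (measure_ne_top _ _) ?_]
  · rw [← integral_toReal]
    · exact hset.symm
    · exact ((Kernel.measurable_coe _ hB).comp hH).aemeasurable
    · exact .of_forall fun ω => measure_lt_top _ _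
  · refine ne_of_lt (lt_of_le_of_lt (lintegral_mono fun ω => prob_le_one) ?_)
    simp

/-- The joint law of two successive draws from an urn with composition `μ`. -/
noncomputable def twoDraws (μ : Measure 𝕏) (R : Kernel 𝕏 𝕏) : Measure (𝕏 × 𝕏) :=
  ((μ Set.univ)⁻¹ • μ) ⊗ₘ (Kernel.const 𝕏 μ + R).normalize

theorem measurable_snoc (n : ℕ) :
    Measurable fun z : (Fin n → 𝕏) × 𝕏 => (Fin.snoc z.1 z.2 : Fin (n + 1) → 𝕏) := by
  refine measurable_pi_lambda _ fun i => ?_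
  refine Fin.lastCases ?_ (fun j => ?_) i
  · simpa using measurable_snd
  · simp only [Fin.snoc_castSucc]
    exact (measurable_pi_apply j).comp (measurable_fst (α := Fin n → 𝕏) (β := 𝕏))

/-- Drawing `x` adds `R x` to the composition, so the next two draws depend on the history only
through the current composition. The kernel `S` records that this dependence is measurable. -/
theorem IsMVPS.exists_kernel_twoDraws [IsProbabilityMeasure ν] (hθ : 0 < θ)
    (hR : ∀ x, IsFiniteMeasure (R x)) (hX : IsMVPS P X θ ν R) (n : ℕ) :
    ∃ S : Kernel (Fin n → 𝕏) (𝕏 × 𝕏), IsMarkovKernel S ∧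
      (∀ h, S h = twoDraws (urnKernel θ ν R n h) R) ∧
      P.map (fun ω => ((fun i : Fin n => X i ω), X n ω, X (n + 1) ω)) =
        P.map (fun ω (i : Fin n) => X i ω) ⊗ₘ S := by
  have hmk := isMarkovKernel_normalize_urnKernel (ν := ν) hθ hR
  have hH : ∀ n, Measurable fun ω (i : Fin n) => X i ω :=
    fun n => measurable_pi_lambda _ fun i => hX.measurable i
  have hp := fun n => Measure.isProbabilityMeasure_map (μ := P) (hH n).aemeasurable
  let η := (urnKernel θ ν R (n + 1)).normalize.comap _ (measurable_snoc n)
  have hη : ∀ h x, η (h, x) = (Kernel.const 𝕏 (urnKernel θ ν R n h) + R).normalize x := by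
    intro h x
    simp only [η, Kernel.comap_apply, Kernel.normalize_apply, urnKernel_snoc]
    simp
  refine ⟨(urnKernel θ ν R n).normalize ⊗ₖ η, inferInstance, fun h => ?_, ?_⟩
  · rw [Kernel.compProd_apply_eq_compProd_sectR, twoDraws]
    congr 1
    ext1 x
    exact hη h x
  · have hX1 : Measurable fun ω => ((fun i : Fin n => X i ω), X n ω) :=
      (hH n).prodMk (hX.measurable n)
    have hX2 : Measurable fun ω => (((fun i : Fin n => X i ω), X n ω), X (n + 1) ω) :=
      hX1.prodMk (hX.measurable (n + 1))
    have hp2 := Measure.isProbabilityMeasure_map (μ := P) hX2.aemeasurable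
    have key : P.map (fun ω => (((fun i : Fin n => X i ω), X n ω), X (n + 1) ω)) =
        (P.map (fun ω (i : Fin n) => X i ω) ⊗ₘ (urnKernel θ ν R n).normalize) ⊗ₘ η := by
      rw [← hX.map_prodMk_eq_compProd hθ hR n]
      have hp1 := Measure.isProbabilityMeasure_map (μ := P) hX1.aemeasurable
      refine Measure.ext_prod fun {A C} hA hC => ?_
      have hu : Measurable fun h : Fin (n + 1) → 𝕏 =>
          ((fun i : Fin n => h i.castSucc), h (Fin.last n)) := by fun_prop
      have h1 := congrArg (fun m => m (((fun h : Fin (n + 1) → 𝕏 =>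
        ((fun i : Fin n => h i.castSucc), h (Fin.last n))) ⁻¹' A) ×ˢ C)) (hX.map_prodMk_eq_compProd hθ hR (n + 1))
      have hsn : ∀ ω, (Fin.snoc (fun i : Fin n => X i ω) (X n ω) : Fin (n + 1) → 𝕏)
          = fun i : Fin (n + 1) => X i ω := by
        intro ω
        ext i
        refine Fin.lastCases ?_ (fun j => ?_) i <;> simp
      beta_reduce at h1
      rw [Measure.compProd_apply_prod (hu hA) hC,
        setLIntegral_map (hu hA) (Kernel.measurable_coe _ hC) (hH _),
        Measure.map_apply ((hH _).prodMk (hX.measurable _)) ((hu hA).prod hC)] at h1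
      rw [Measure.compProd_apply_prod hA hC, setLIntegral_map hA (Kernel.measurable_coe _ hC) hX1,
        Measure.map_apply hX2 (hA.prod hC)]
      simp only [η, Kernel.comap_apply, hsn]
      exact h1
    rw [← Measure.compProd_assoc', ← key, Measure.map_map (by fun_prop) hX2]
    rfl

/-- Transposing the last two of `n + 2` indices fixes the history, so the conditional law and its
swap disintegrate the same joint law and agree for almost every history. -/
theorem IsMVPS.ae_twoDraws_map_swap [MeasurableSpace.CountablyGenerated 𝕏]
    [IsProbabilityMeasure ν] (hθ : 0 < θ) (hR : ∀ x, IsFiniteMeasure (R x))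
    (hX : IsMVPS P X θ ν R) (hexch : IsExchangeable P X) (n : ℕ) :
    ∀ᵐ h ∂(P.map fun ω (i : Fin n) => X i ω),
      (twoDraws (urnKernel θ ν R n h) R).map Prod.swap = twoDraws (urnKernel θ ν R n h) R := by
  obtain ⟨S, hS, hS', hlaw⟩ := hX.exists_kernel_twoDraws hθ hR n
  have hH : ∀ n, Measurable fun ω (i : Fin n) => X i ω :=
    fun n => measurable_pi_lambda _ fun i => hX.measurable i
  have hp := fun n => Measure.isProbabilityMeasure_map (μ := P) (hH n).aemeasurable
  have hS2 : IsMarkovKernel (S.map Prod.swap) := Kernel.IsMarkovKernel.map _ measurable_swap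
  have heq : P.map (fun ω (i : Fin n) => X i ω) ⊗ₘ (S.map Prod.swap)
      = P.map (fun ω (i : Fin n) => X i ω) ⊗ₘ S := by
    have hg : Measurable fun h : Fin (n + 2) → 𝕏 =>
        ((fun i : Fin n => h i.castSucc.castSucc), h (Fin.last n).castSucc, h (Fin.last (n + 1))) :=
      by fun_prop
    have hperm := congrArg (Measure.map fun h : Fin (n + 2) → 𝕏 =>
      ((fun i : Fin n => h i.castSucc.castSucc), h (Fin.last n).castSucc, h (Fin.last (n + 1))))
      (hexch (n + 2) (Equiv.swap (Fin.last n).castSucc (Fin.last (n + 1))))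
    rw [Measure.map_map hg (measurable_pi_lambda _ fun i => hX.measurable _),
      Measure.map_map hg (hH _)] at hperm
    rw [Measure.compProd_map measurable_swap, ← hlaw, Measure.map_map (by fun_prop)
      ((hH n).prodMk ((hX.measurable _).prodMk (hX.measurable _)))]
    refine Eq.trans (congrArg (fun g => P.map g) ?_) hperm
    ext ω i
    · have h1 : i.castSucc.castSucc ≠ (Fin.last n).castSucc := by
        simp [Fin.ext_iff, i.2.ne]
      have h2 : i.castSucc.castSucc ≠ Fin.last (n + 1) := Fin.castSucc_ne_last _
      simp [Equiv.swap_apply_of_ne_of_ne h1 h2]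
    · simp
    · simp
  filter_upwards [Kernel.ae_eq_of_compProd_eq heq] with h hh
  rw [Kernel.map_apply _ measurable_swap, hS'] at hh
  exact hh

end Urn

/-! ### Calculus of bounded measurable functions. -/

section BoundedMeasurable

variable {α β : Type*} [MeasurableSpace α] [MeasurableSpace β]

/-- Bounded measurable real functions. -/
structure IsBddMeas (g : α → ℝ) : Prop where
  measurable : Measurable g
  bounded : ∃ C, ∀ z, |g z| ≤ C

namespace IsBddMeas

variable {g h : α → ℝ}

theorem const (c : ℝ) : IsBddMeas fun _ : α => c := ⟨measurable_const, |c|, fun _ => le_rfl⟩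

theorem of_mem_Icc (hg : Measurable g) (h0 : ∀ x, 0 ≤ g x) (h1 : ∀ x, g x ≤ 1) : IsBddMeas g :=
  ⟨hg, 1, fun x => by rw [abs_of_nonneg (h0 x)]; exact h1 x⟩

theorem mul (hg : IsBddMeas g) (hh : IsBddMeas h) : IsBddMeas fun x => g x * h x := by
  obtain ⟨C, hC⟩ := hg.bounded
  obtain ⟨D, hD⟩ := hh.bounded
  refine ⟨hg.measurable.mul hh.measurable, C * D, fun x => ?_⟩
  rw [abs_mul]
  exact mul_le_mul (hC x) (hD x) (abs_nonneg _) ((abs_nonneg _).trans (hC x))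

theorem add (hg : IsBddMeas g) (hh : IsBddMeas h) : IsBddMeas fun x => g x + h x := by
  obtain ⟨C, hC⟩ := hg.bounded
  obtain ⟨D, hD⟩ := hh.bounded
  exact ⟨hg.measurable.add hh.measurable, C + D,
    fun x => (abs_add_le _ _).trans (add_le_add (hC x) (hD x))⟩

theorem neg (hg : IsBddMeas g) : IsBddMeas fun x => -g x := by
  obtain ⟨C, hC⟩ := hg.bounded
  exact ⟨hg.measurable.neg, C, fun x => by rw [abs_neg]; exact hC x⟩

theorem sub (hg : IsBddMeas g) (hh : IsBddMeas h) : IsBddMeas fun x => g x - h x := by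
  simpa only [sub_eq_add_neg] using hg.add hh.neg

theorem comp (hg : IsBddMeas g) {u : β → α} (hu : Measurable u) : IsBddMeas fun x => g (u x) := by
  obtain ⟨C, hC⟩ := hg.bounded
  exact ⟨hg.measurable.comp hu, C, fun x => hC _⟩

theorem fst (hg : IsBddMeas g) : IsBddMeas fun z : α × β => g z.1 := hg.comp measurable_fst

theorem snd (hg : IsBddMeas g) : IsBddMeas fun z : β × α => g z.2 := hg.comp measurable_snd

theorem section_right {k : α × β → ℝ} (hk : IsBddMeas k) (x : α) : IsBddMeas fun y => k (x, y) :=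
  hk.comp measurable_prodMk_left

theorem indicator_one {s : Set α} (hs : MeasurableSet s) :
    IsBddMeas (s.indicator fun _ => (1 : ℝ)) :=
  of_mem_Icc (measurable_const.indicator hs) (Set.indicator_nonneg fun _ _ => zero_le_one)
    (Set.indicator_le_self' (f := fun _ : α => (1 : ℝ)) fun _ _ => zero_le_one)

theorem integrable (hg : IsBddMeas g) (μ : Measure α) [IsFiniteMeasure μ] : Integrable g μ := by
  obtain ⟨C, hC⟩ := hg.bounded
  exact Integrable.of_bound hg.measurable.aestronglyMeasurable C (.of_forall hC)

theorem integral_kernel {k : α × β → ℝ} (hk : IsBddMeas k) (K : Kernel α β) [IsMarkovKernel K] :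
    IsBddMeas fun x => ∫ y, k (x, y) ∂(K x) := by
  obtain ⟨C, hC⟩ := hk.bounded
  refine ⟨(StronglyMeasurable.integral_kernel_prod_right' hk.measurable.stronglyMeasurable).measurable,
    C, fun x => ?_⟩
  have := norm_integral_le_of_norm_le_const (μ := K x) (f := fun y => k (x, y)) (C := C)
    (.of_forall fun y => hC _)
  simpa using this

theorem integral_compProd {k : α × β → ℝ} (hk : IsBddMeas k) (μ : Measure α) [IsFiniteMeasure μ]
    (K : Kernel α β) [IsMarkovKernel K] :
    ∫ z, k z ∂(μ ⊗ₘ K) = ∫ x, ∫ y, k (x, y) ∂(K x) ∂μ :=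
  Measure.integral_compProd (hk.integrable _)

end IsBddMeas

end BoundedMeasurable

/-! ### From symmetry of two draws to an identity of degree two in the composition. -/

section UrnIdentity

variable {𝕏 : Type*} [MeasurableSpace 𝕏]

/-- Bounded measurable functions `k` with `k (y, x) = - k (x, y)`. -/
structure IsAntisymmTest (k : 𝕏 × 𝕏 → ℝ) : Prop extends IsBddMeas k where
  swap : ∀ z, k z.swap = -k z

/-- The relation that exchangeability of two successive draws imposes on an urn of composition `μ`,
tested against antisymmetric functions. -/
def UrnIdentity (K : Kernel 𝕏 𝕏) (q : 𝕏 → ℝ) (μ : Measure 𝕏) : Prop :=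
  ∀ k : 𝕏 × 𝕏 → ℝ, IsAntisymmTest k →
    μ.real Set.univ * ∫ z, k z * (q z.1 * (1 - q z.2)) ∂(μ ⊗ₘ K)
      + ∫ z, k z * (q z.1 * q z.2) ∂(μ ⊗ₘ K) = ∫ z, k z * q z.1 ∂(μ.prod μ)

theorem integral_eq_zero_of_swap_eq_neg {Λ : Measure (𝕏 × 𝕏)} (hΛ : Λ.map Prod.swap = Λ)
    {g : 𝕏 × 𝕏 → ℝ} (hg : Measurable g) (hswap : ∀ z, g z.swap = -g z) : ∫ z, g z ∂Λ = 0 := by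
  have h1 : ∫ z, g z ∂(Λ.map Prod.swap) = ∫ z, g z.swap ∂Λ :=
    integral_map measurable_swap.aemeasurable hg.aestronglyMeasurable
  rw [hΛ] at h1
  simp only [hswap, integral_neg] at h1
  linarith

/-- The second draw has law `(μ + f(x) K x) / (m + f(x))`, with `m` the mass of `μ`. Integrating an
antisymmetric `k` times the symmetric weight `w(x) w(y)` against the symmetric two-draw law gives
zero. The choice `w = (m + f) / (1 + f)` cancels the denominator and leaves only bounded functions
of `q`. -/
theorem urnIdentity_of_twoDraws_map_swap {K R : Kernel 𝕏 𝕏} [IsMarkovKernel K] {f : 𝕏 → ℝ≥0}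
    (hf : Measurable f) {θ : ℝ≥0} (hθ : 0 < θ) (hR : ∀ x, R x = (θ * f x) • K x)
    {μ : Measure 𝕏} [IsFiniteMeasure μ] (hμ : μ ≠ 0)
    (hsymm : (twoDraws (θ • μ) R).map Prod.swap = twoDraws (θ • μ) R) :
    UrnIdentity K (fun x => f x / (1 + f x)) μ := by
  have : NeZero μ := ⟨hμ⟩
  set T := (Kernel.const 𝕏 (θ • μ) + R).normalize with hTdef
  set m := μ.real Set.univ with hm
  have hmpos : 0 < m := measureReal_univ_pos
  have hTbase : ∀ x, (Kernel.const 𝕏 (θ • μ) + R) x = θ • μ + (θ * f x) • K x := fun x => by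
    simp [hR]
  have hTmass : ∀ x, ((Kernel.const 𝕏 (θ • μ) + R) x).real Set.univ = θ * (m + f x) := fun x => by
    rw [hTbase, measureReal_add_apply, measureReal_nnreal_smul_apply,
      measureReal_nnreal_smul_apply, probReal_univ (μ := K x)]
    push_cast
    ring
  have hT : IsMarkovKernel T := by
    refine Kernel.isMarkovKernel_normalize (fun x => ?_) fun x => ?_
    · rw [hTbase]
      simp [hθ.ne', hμ]
    · rw [hTbase]
      exact measure_ne_top _ _
  have hsymm' : (μ ⊗ₘ T).map Prod.swap = μ ⊗ₘ T := by
    -- The two-draw law is a positive finite multiple of `μ ⊗ₘ T`, so the symmetry passes to the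
    -- latter.
    set c : ENNReal := ((θ • μ) Set.univ)⁻¹ * θ with hc
    have h1 : twoDraws (θ • μ) R = c • (μ ⊗ₘ T) := by
      rw [twoDraws, ← Measure.compProd_smul_left, hc, ← smul_smul]
      rfl
    have hc0 : c ≠ 0 := by simp [hc, hθ.ne', ENNReal.mul_eq_top]
    have hct : c ≠ ⊤ := by
      refine ENNReal.mul_ne_top (ENNReal.inv_ne_top.2 ?_) (by simp)
      simp [hθ.ne', hμ]
    rw [h1, Measure.map_smul] at hsymm
    ext s hs
    have h2 := congrArg (fun ρ => ρ s) hsymm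
    simpa [hc0, hct, ENNReal.mul_right_inj] using h2
  have hTint : ∀ (g : 𝕏 → ℝ) (x : 𝕏), IsBddMeas g →
      ∫ y, g y ∂(T x) = (m + f x)⁻¹ * (∫ y, g y ∂μ + f x * ∫ y, g y ∂(K x)) := by
    intro g x hg
    rw [hTdef, Kernel.normalize_apply, integral_smul_measure, ENNReal.toReal_inv,
      ← measureReal_def, hTmass, hTbase, integral_add_measure (hg.integrable _)
      (hg.integrable _), integral_smul_nnreal_measure, integral_smul_nnreal_measure]
    have : (θ : ℝ) ≠ 0 := by exact_mod_cast hθ.ne'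
    simp only [NNReal.smul_def, smul_eq_mul, NNReal.coe_mul, mul_inv]
    field_simp
  intro k hk
  set q : 𝕏 → ℝ := fun x => f x / (1 + f x) with hq
  have hqm : Measurable q := by fun_prop
  have hq0 : ∀ x, 0 ≤ q x := fun x => by positivity
  have hq1 : ∀ x, q x ≤ 1 := fun x => by
    rw [hq]
    exact (div_le_one (by positivity)).2 (by linarith)
  have hfq : ∀ x, (f x : ℝ) * (1 - q x) = q x := fun x => by
    have : (1 + f x : ℝ) ≠ 0 := by positivity
    simp only [hq]
    field_simp
    ring
  set w : 𝕏 → ℝ := fun x => m * (1 - q x) + q x with hw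
  have hwp : ∀ x, (m + f x)⁻¹ * w x = 1 - q x := fun x => by
    have h1 : (m + f x : ℝ) ≠ 0 := by positivity
    rw [inv_mul_eq_iff_eq_mul₀ h1]
    simp only [hw]
    linear_combination -hfq x
  have hqb : IsBddMeas q := .of_mem_Icc hqm hq0 hq1
  have hwb : IsBddMeas w := ((IsBddMeas.const m).mul ((IsBddMeas.const 1).sub hqb)).add hqb
  have hkb := hk.toIsBddMeas
  have hpb : IsBddMeas fun x => 1 - q x := (IsBddMeas.const 1).sub hqb
  have h0 : ∫ z, k z * (w z.1 * w z.2) ∂(μ ⊗ₘ T) = 0 := by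
    refine integral_eq_zero_of_swap_eq_neg hsymm' (hkb.mul (hwb.fst.mul hwb.snd)).measurable
      fun z => ?_
    rw [hk.swap]
    simp only [Prod.fst_swap, Prod.snd_swap]
    ring
  have h1 : ∫ z, k z * (w z.1 * w z.2) ∂(μ ⊗ₘ T)
      = ∫ z, k z * ((1 - q z.1) * w z.2) ∂(μ.prod μ) + ∫ z, k z * (q z.1 * w z.2) ∂(μ ⊗ₘ K) := by
    have hb1 := hkb.mul (hpb.fst.mul hwb.snd)
    have hb2 := hkb.mul (hqb.fst.mul hwb.snd)
    rw [(hkb.mul (hwb.fst.mul hwb.snd)).integral_compProd, hb2.integral_compProd,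
      integral_prod _ (hb1.integrable _), ← integral_add (hb1.integrable _).integral_prod_left
        ((hb2.integral_kernel K).integrable _)]
    refine integral_congr_ae (.of_forall fun x => ?_)
    beta_reduce
    rw [hTint _ _ ((hkb.mul (hwb.fst.mul hwb.snd)).section_right x)]
    have e1 : ∀ c, ∀ ρ : Measure 𝕏, ∫ y, k (x, y) * (c * w y) ∂ρ = c * ∫ y, k (x, y) * w y ∂ρ := by
      intro c ρ
      rw [← integral_const_mul]
      exact integral_congr_ae (.of_forall fun y => by ring)
    simp only [e1]
    linear_combination (∫ y, k (x, y) * w y ∂μ + f x * ∫ y, k (x, y) * w y ∂(K x)) * hwp x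
      + (∫ y, k (x, y) * w y ∂(K x)) * hfq x
  -- Expanded, the factor of `k` is `m (1 - q x)(1 - q y) + q x + q y - q x q y`, which is
  -- symmetric.
  have h2 : ∫ z, k z * ((1 - q z.1) * w z.2 + q z.1) ∂(μ.prod μ) = 0 := by
    refine integral_eq_zero_of_swap_eq_neg Measure.prod_swap
      (hkb.mul ((hpb.fst.mul hwb.snd).add hqb.fst)).measurable fun z => ?_
    rw [hk.swap]
    simp only [Prod.fst_swap, Prod.snd_swap, hw]
    ring
  have h3 : ∫ z, k z * ((1 - q z.1) * w z.2 + q z.1) ∂(μ.prod μ)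
      = ∫ z, k z * ((1 - q z.1) * w z.2) ∂(μ.prod μ) + ∫ z, k z * q z.1 ∂(μ.prod μ) := by
    rw [← integral_add ((hkb.mul (hpb.fst.mul hwb.snd)).integrable _)
      ((hkb.mul hqb.fst).integrable _)]
    simp only [mul_add]
  have h4 : ∫ z, k z * (q z.1 * w z.2) ∂(μ ⊗ₘ K)
      = m * ∫ z, k z * (q z.1 * (1 - q z.2)) ∂(μ ⊗ₘ K) + ∫ z, k z * (q z.1 * q z.2) ∂(μ ⊗ₘ K) := by
    rw [← integral_const_mul, ← integral_add
      (((hkb.mul (hqb.fst.mul hpb.snd)).integrable _).const_mul m)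
      ((hkb.mul (hqb.fst.mul hqb.snd)).integrable _)]
    refine integral_congr_ae (.of_forall fun z => ?_)
    simp only [hw]
    ring
  linarith

end UrnIdentity

/-! ### Symmetry after zero, one and two draws, for almost every point under `ν` or `ν.prod ν`. -/

section Transfer

variable {Ω 𝕏 : Type*} [MeasurableSpace Ω] [MeasurableSpace 𝕏]
  [MeasurableSpace.CountablyGenerated 𝕏] {θ : ℝ≥0} {ν : Measure 𝕏} [IsProbabilityMeasure ν]
  {R : Kernel 𝕏 𝕏} {P : Measure Ω} [IsProbabilityMeasure P] {X : ℕ → Ω → 𝕏}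

theorem IsMVPS.twoDraws_zero_map_swap (hθ : 0 < θ) (hR : ∀ x, IsFiniteMeasure (R x))
    (hX : IsMVPS P X θ ν R) (hexch : IsExchangeable P X) :
    (twoDraws (θ • ν) R).map Prod.swap = twoDraws (θ • ν) R := by
  have hH : Measurable fun ω (i : Fin 0) => X i ω := measurable_pi_lambda _ fun i => hX.measurable i
  have hp := Measure.isProbabilityMeasure_map (μ := P) hH.aemeasurable
  obtain ⟨h, hh⟩ := (hX.ae_twoDraws_map_swap hθ hR hexch 0).exists
  simpa [urnKernel_apply] using hh

theorem IsMVPS.ae_twoDraws_one_map_swap (hθ : 0 < θ) (hR : ∀ x, IsFiniteMeasure (R x))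
    (hX : IsMVPS P X θ ν R) (hexch : IsExchangeable P X) :
    ∀ᵐ z ∂ν, (twoDraws (θ • ν + R z) R).map Prod.swap = twoDraws (θ • ν + R z) R := by
  have hm : Measurable fun (z : 𝕏) (_ : Fin 1) => z := by fun_prop
  have hlaw : P.map (fun ω (i : Fin 1) => X i ω) = ν.map fun z _ => z := by
    rw [← hX.map_zero, Measure.map_map hm (hX.measurable 0)]
    congr 1
    ext ω i
    simp [Subsingleton.elim i 0]
  have h := hX.ae_twoDraws_map_swap hθ hR hexch 1
  rw [hlaw] at h
  filter_upwards [ae_of_ae_map hm.aemeasurable h] with z hz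
  simpa [urnKernel_apply] using hz

theorem IsMVPS.ae_twoDraws_two_map_swap (hθ : 0 < θ) (hR : ∀ x, IsFiniteMeasure (R x))
    (hX : IsMVPS P X θ ν R) (hexch : IsExchangeable P X) :
    ∀ᵐ z ∂(ν.prod ν), (twoDraws (θ • ν + R z.1 + R z.2) R).map Prod.swap
      = twoDraws (θ • ν + R z.1 + R z.2) R := by
  have hm : Measurable fun (z : 𝕏 × 𝕏) => ![z.1, z.2] := by
    refine measurable_pi_lambda _ fun i => ?_
    fin_cases i
    · exact measurable_fst
    · exact measurable_snd
  have hX2 : Measurable fun ω => (X 0 ω, X 1 ω) := (hX.measurable 0).prodMk (hX.measurable 1)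
  have hH : Measurable fun ω (i : Fin 0) => X i ω := measurable_pi_lambda _ fun i => hX.measurable i
  have hp := Measure.isProbabilityMeasure_map (μ := P) hH.aemeasurable
  have hT : IsMarkovKernel (Kernel.const 𝕏 (θ • ν) + R).normalize := by
    refine Kernel.isMarkovKernel_normalize (fun x => ?_) fun x => ?_
    · simp [hθ.ne']
    · simp
  have hlaw2 : P.map (fun ω => (X 0 ω, X 1 ω)) = ν ⊗ₘ (Kernel.const 𝕏 (θ • ν) + R).normalize := by
    obtain ⟨S, hS, hS', hSlaw⟩ := hX.exists_kernel_twoDraws hθ hR 0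
    have h1 := congrArg Measure.snd hSlaw
    rw [Measure.snd, Measure.map_map measurable_snd (hH.prodMk hX2), Measure.snd_compProd] at h1
    have h2 : P.map (fun ω (i : Fin 0) => X i ω) = Measure.dirac default := by
      rw [show (fun ω (i : Fin 0) => X i ω) = fun _ => default from
        funext fun _ => Subsingleton.elim _ _, Measure.map_const, measure_univ, one_smul]
    rw [h2, Measure.dirac_bind S.measurable, hS'] at h1
    have h3 : ((θ • ν) Set.univ)⁻¹ • (θ • ν) = ν := by
      ext s hs
      have : (θ : ENNReal) ≠ 0 := by exact_mod_cast hθ.ne'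
      change ((θ : ENNReal) * ν Set.univ)⁻¹ * ((θ : ENNReal) * ν s) = ν s
      rw [measure_univ, mul_one, ← mul_assoc, ENNReal.inv_mul_cancel this ENNReal.coe_ne_top,
        one_mul]
    simp only [urnKernel_apply, Finset.univ_eq_empty, Finset.sum_empty, add_zero, twoDraws,
      h3] at h1
    exact h1
  have hlaw : P.map (fun ω (i : Fin 2) => X i ω)
      = (ν ⊗ₘ (Kernel.const 𝕏 (θ • ν) + R).normalize).map fun z => ![z.1, z.2] := by
    rw [← hlaw2, Measure.map_map hm hX2]
    congr 1
    ext ω i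
    fin_cases i <;> rfl
  -- The first two draws are not independent, but the second is drawn from a composition that
  -- contains `θ ν`; hence null sets for their joint law are null for the product.
  have hac : ν.prod ν ≪ ν ⊗ₘ (Kernel.const 𝕏 (θ • ν) + R).normalize := by
    rw [← Measure.compProd_const]
    refine Measure.AbsolutelyContinuous.compProd_right (.of_forall fun x => ?_)
    refine Measure.AbsolutelyContinuous.mk fun s hs h0 => ?_
    simp only [Kernel.normalize_apply, FunLike.coe_add, Pi.add_apply, Kernel.const_apply,
      Measure.smul_apply, Measure.add_apply, smul_eq_mul, mul_eq_zero] at h0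
    rcases h0 with h0 | h0
    · simp at h0
    · rw [add_eq_zero] at h0
      simpa [hθ.ne'] using h0.1
  have h := hX.ae_twoDraws_map_swap hθ hR hexch 2
  rw [hlaw] at h
  filter_upwards [hac.ae_le (ae_of_ae_map hm.aemeasurable h)] with z hz
  simpa [urnKernel_apply, ← add_assoc] using hz

end Transfer

/-! ### Consequences of the urn identities. -/

section UrnConsequences

variable {𝕏 : Type*} [MeasurableSpace 𝕏]

theorem map_swap_eq_of_forall_isAntisymmTest {Λ : Measure (𝕏 × 𝕏)} [IsFiniteMeasure Λ]
    (h : ∀ k, IsAntisymmTest k → ∫ z, k z ∂Λ = 0) : Λ.map Prod.swap = Λ := by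
  ext s hs
  have hs' : MeasurableSet (Prod.swap ⁻¹' s) := measurable_swap hs
  have hk : IsAntisymmTest fun z => (Prod.swap ⁻¹' s).indicator (fun _ => (1 : ℝ)) z
      - s.indicator (fun _ => (1 : ℝ)) z := by
    refine ⟨(IsBddMeas.indicator_one hs').sub (IsBddMeas.indicator_one hs), fun z => ?_⟩
    rw [neg_sub]
    rfl
  have h1 := h _ hk
  rw [integral_sub ((IsBddMeas.indicator_one hs').integrable _)
    ((IsBddMeas.indicator_one hs).integrable _), integral_indicator hs', integral_indicator hs,
    setIntegral_one_eq_measureReal, setIntegral_one_eq_measureReal, sub_eq_zero,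
    measureReal_eq_measureReal_iff] at h1
  rw [Measure.map_apply measurable_swap hs, h1]

/-- The antisymmetric function `(x, y) ↦ g x * h y - h x * g y`. -/
theorem IsAntisymmTest.wedge {g h : 𝕏 → ℝ} (hg : IsBddMeas g) (hh : IsBddMeas h) :
    IsAntisymmTest fun z => g z.1 * h z.2 - h z.1 * g z.2 :=
  ⟨(hg.fst.mul hh.snd).sub (hh.fst.mul hg.snd), fun z => by
    simp only [Prod.fst_swap, Prod.snd_swap]
    ring⟩

variable {ν : Measure 𝕏} [IsProbabilityMeasure ν] {K : Kernel 𝕏 𝕏} [IsMarkovKernel K]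
  {f : 𝕏 → ℝ≥0} {q : 𝕏 → ℝ}

theorem UrnIdentity.integral_compProd_eq (hq : IsBddMeas q) (h1 : UrnIdentity K q ν)
    {k : 𝕏 × 𝕏 → ℝ} (hk : IsAntisymmTest k) :
    ∫ z, k z * q z.1 ∂(ν ⊗ₘ K) = ∫ z, k z * q z.1 ∂(ν.prod ν) := by
  have hkb := hk.toIsBddMeas
  rw [← h1 k hk, probReal_univ, one_mul, ← integral_add
    ((hkb.mul (hq.fst.mul ((IsBddMeas.const 1).sub hq).snd)).integrable _)
    ((hkb.mul (hq.fst.mul hq.snd)).integrable _)]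
  refine integral_congr_ae (.of_forall fun z => ?_)
  ring

theorem UrnIdentity.integral_wedge (hq : IsBddMeas q) (h1 : UrnIdentity K q ν) {g h : 𝕏 → ℝ}
    (hg : IsBddMeas g) (hh : IsBddMeas h) :
    ∫ x, g x * q x * ∫ y, h y ∂(K x) ∂ν - ∫ x, h x * q x * ∫ y, g y ∂(K x) ∂ν
      = (∫ x, g x * q x ∂ν) * ∫ y, h y ∂ν - (∫ x, h x * q x ∂ν) * ∫ y, g y ∂ν := by
  have key := h1.integral_compProd_eq hq (.wedge hg hh)
  have e1 := ((hg.fst.mul hh.snd).mul hq.fst).integrable (ν ⊗ₘ K)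
  have e2 := ((hh.fst.mul hg.snd).mul hq.fst).integrable (ν ⊗ₘ K)
  have e3 := ((hg.fst.mul hh.snd).mul hq.fst).integrable (ν.prod ν)
  have e4 := ((hh.fst.mul hg.snd).mul hq.fst).integrable (ν.prod ν)
  have hK : ∀ {a b : 𝕏 → ℝ}, IsBddMeas a → IsBddMeas b →
      ∫ z, a z.1 * b z.2 * q z.1 ∂(ν ⊗ₘ K) = ∫ x, a x * q x * ∫ y, b y ∂(K x) ∂ν := by
    intro a b ha hb
    rw [((ha.fst.mul hb.snd).mul hq.fst).integral_compProd]
    refine integral_congr_ae (.of_forall fun x => ?_)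
    beta_reduce
    rw [← integral_const_mul]
    refine integral_congr_ae (.of_forall fun y => ?_)
    ring
  have hP : ∀ {a b : 𝕏 → ℝ}, IsBddMeas a → IsBddMeas b →
      ∫ z, a z.1 * b z.2 * q z.1 ∂(ν.prod ν) = (∫ x, a x * q x ∂ν) * ∫ y, b y ∂ν := by
    intro a b ha hb
    rw [← integral_prod_mul]
    refine integral_congr_ae (.of_forall fun x => ?_)
    ring
  simp only [sub_mul] at key
  rwa [integral_sub e1 e2, integral_sub e3 e4, hK hg hh, hK hh hg, hP hg hh, hP hh hg] at key

/-- This is the wedge identity with `g = 1`: up to a constant, `K` sends the measure `q ν` to `ν`.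
-/
theorem UrnIdentity.integral_mul_integral_kernel (hq : IsBddMeas q) (h1 : UrnIdentity K q ν)
    {h : 𝕏 → ℝ} (hh : IsBddMeas h) :
    ∫ x, q x * ∫ y, h y ∂(K x) ∂ν = (∫ x, q x ∂ν) * ∫ y, h y ∂ν := by
  have := h1.integral_wedge hq (.const 1) hh
  simp only [one_mul, integral_const, probReal_univ, smul_eq_mul, mul_one] at this
  linarith

theorem ae_eq_zero_of_integral_mul_sq_eq_zero {g : 𝕏 → ℝ} (hq : IsBddMeas q)
    (hqpos : ∀ᵐ x ∂ν, 0 < q x) (hg : IsBddMeas g) (h : ∫ x, q x * (g x * g x) ∂ν = 0) :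
    ∀ᵐ x ∂ν, g x = 0 := by
  rw [integral_eq_zero_iff_of_nonneg_ae (by
    filter_upwards [hqpos] with x hx
    exact mul_nonneg hx.le (mul_self_nonneg _)) ((hq.mul (hg.mul hg)).integrable _)] at h
  filter_upwards [h, hqpos] with x hx hqx
  simpa [hqx.ne'] using hx

/-- For a `ν`-null set `N`, the `q`-weighted mean of `K z N` is a multiple of `ν N = 0`, and `q > 0`
a.e. -/
theorem UrnIdentity.ae_ae_kernel (hq : IsBddMeas q) (hqpos : ∀ᵐ x ∂ν, 0 < q x)
    (h1 : UrnIdentity K q ν) {p : 𝕏 → Prop} (hp : ∀ᵐ x ∂ν, p x) :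
    ∀ᵐ z ∂ν, ∀ᵐ x ∂(K z), p x := by
  obtain ⟨N, hN, hNm, hN0⟩ := exists_measurable_superset_of_null (ae_iff.1 hp)
  have hb := IsBddMeas.indicator_one hNm
  have hi : ∀ ρ : Measure 𝕏, ∫ y, N.indicator (fun _ => (1 : ℝ)) y ∂ρ = ρ.real N := fun ρ => by
    rw [integral_indicator hNm, setIntegral_one_eq_measureReal]
  have hKb := hb.snd.integral_kernel K
  have h2 := h1.integral_mul_integral_kernel hq hb
  simp only [hi] at h2 hKb
  rw [measureReal_def, hN0, ENNReal.toReal_zero, mul_zero, integral_eq_zero_iff_of_nonneg_ae (by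
    filter_upwards [hqpos] with x hx
    exact mul_nonneg hx.le measureReal_nonneg) ((hq.mul hKb).integrable _)] at h2
  filter_upwards [h2, hqpos] with z hz hqz
  have h3 : (K z).real N = 0 := by simpa [hqz.ne'] using hz
  rw [measureReal_eq_zero_iff] at h3
  exact measure_mono_null hN h3

/-- The alternating sum over `ν`, `ν + a`, `ν + b`, `ν + a + b` keeps only the cross terms in `a`
and `b`. The linear term drops out, and antisymmetry of `k` merges the two cross products on the
right. -/
theorem UrnIdentity.secondDifference (hq : IsBddMeas q) {a b : Measure 𝕏} [IsFiniteMeasure a]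
    [IsFiniteMeasure b] (h : UrnIdentity K q ν) (ha : UrnIdentity K q (ν + a))
    (hb : UrnIdentity K q (ν + b)) (hab : UrnIdentity K q (ν + a + b))
    {k : 𝕏 × 𝕏 → ℝ} (hk : IsAntisymmTest k) :
    a.real Set.univ * ∫ z, k z * (q z.1 * (1 - q z.2)) ∂(b ⊗ₘ K)
      + b.real Set.univ * ∫ z, k z * (q z.1 * (1 - q z.2)) ∂(a ⊗ₘ K)
      = ∫ z, k z * (q z.1 - q z.2) ∂(a.prod b) := by
  have hkb := hk.toIsBddMeas
  have hc := hkb.mul (hq.fst.mul ((IsBddMeas.const 1).sub hq).snd)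
  have hd := hkb.mul (hq.fst.mul (hq.snd (β := 𝕏)))
  have he := hkb.mul (hq.fst (β := 𝕏))
  have he' := hkb.mul (hq.snd (β := 𝕏))
  have hadd : ∀ {g : 𝕏 × 𝕏 → ℝ}, IsBddMeas g → ∀ (μ ρ : Measure (𝕏 × 𝕏)), IsFiniteMeasure μ →
      IsFiniteMeasure ρ → ∫ z, g z ∂(μ + ρ) = ∫ z, g z ∂μ + ∫ z, g z ∂ρ :=
    fun hg μ ρ _ _ => integral_add_measure (hg.integrable _) (hg.integrable _)
  have hsw : ∫ z, k z * q z.1 ∂(b.prod a) = - ∫ z, k z * q z.2 ∂(a.prod b) := by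
    rw [← integral_prod_swap, ← integral_neg]
    refine integral_congr_ae (.of_forall fun z => ?_)
    simp [hk.swap]
  have hsub : ∫ z, k z * (q z.1 - q z.2) ∂(a.prod b)
      = ∫ z, k z * q z.1 ∂(a.prod b) - ∫ z, k z * q z.2 ∂(a.prod b) := by
    rw [← integral_sub (he.integrable _) (he'.integrable _)]
    simp only [mul_sub]
  have hma : (ν + a).real Set.univ = ν.real Set.univ + a.real Set.univ := measureReal_add_apply
  have hmb : (ν + b).real Set.univ = ν.real Set.univ + b.real Set.univ := measureReal_add_apply
  have hmab : (ν + a + b).real Set.univ = (ν + a).real Set.univ + b.real Set.univ :=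
    measureReal_add_apply
  have h0 := h k hk
  have h1 := ha k hk
  have h2 := hb k hk
  have h3 := hab k hk
  simp only [Measure.compProd_add_left, Measure.prod_add, Measure.add_prod, hmab, hma, hmb,
    hadd hc _ _ inferInstance inferInstance, hadd hd _ _ inferInstance inferInstance,
    hadd he _ _ inferInstance inferInstance] at h0 h1 h2 h3
  linarith

/-- The relation between the transitions from two independent points with law `ν` that
exchangeability of an urn with reinforcement proportional to `K` imposes. -/
def PairIdentity (ν : Measure 𝕏) (K : Kernel 𝕏 𝕏) (q : 𝕏 → ℝ) : Prop :=
  ∀ᵐ z ∂(ν.prod ν), ∀ k, IsAntisymmTest k →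
    ∫ v, k v * (q v.1 - q v.2) ∂((K z.1).prod (K z.2))
      = ∫ v, k v * (q v.1 * (1 - q v.2)) ∂(K z.1 ⊗ₘ K)
        + ∫ v, k v * (q v.1 * (1 - q v.2)) ∂(K z.2 ⊗ₘ K)

theorem pairIdentity_of_urnIdentity (hq : IsBddMeas q) (hf : ∀ᵐ x ∂ν, 0 < f x)
    (h1 : UrnIdentity K q ν) (h2 : ∀ᵐ z ∂ν, UrnIdentity K q (ν + f z • K z))
    (h3 : ∀ᵐ z ∂(ν.prod ν), UrnIdentity K q (ν + f z.1 • K z.1 + f z.2 • K z.2)) :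
    PairIdentity ν K q := by
  have hfst := Measure.quasiMeasurePreserving_fst (μ := ν) (ν := ν)
  have hsnd := Measure.quasiMeasurePreserving_snd (μ := ν) (ν := ν)
  filter_upwards [h3, hfst.ae h2, hsnd.ae h2, hfst.ae hf, hsnd.ae hf] with z h3z h21 h22 hf1 hf2
    k hk
  have key := h1.secondDifference hq h21 h22 h3z hk
  have hsm : ∀ (c : ℝ≥0) (ρ : Measure 𝕏), c • ρ = (c : ENNReal) • ρ := fun _ _ => rfl
  simp only [hsm, Measure.compProd_smul_left, Measure.prod_smul_left, Measure.prod_smul_right,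
    integral_smul_measure, measureReal_ennreal_smul_apply, probReal_univ, ENNReal.coe_toReal,
    smul_eq_mul, mul_one] at key
  have e1 : (f z.1 : ℝ) ≠ 0 := by exact_mod_cast hf1.ne'
  have e2 : (f z.2 : ℝ) ≠ 0 := by exact_mod_cast hf2.ne'
  refine mul_left_cancel₀ (mul_ne_zero e1 e2) ?_
  linarith

end UrnConsequences

/-! ### Sets on which `q` takes disjoint values. -/

section Separation

variable {𝕏 : Type*} [MeasurableSpace 𝕏] {ν : Measure 𝕏} [IsProbabilityMeasure ν]
  {K : Kernel 𝕏 𝕏} [IsMarkovKernel K] {f : 𝕏 → ℝ≥0} {q : 𝕏 → ℝ}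

/-- The right side of the pair identity is a function of `z.1` plus a function of `z.2`, so it is
orthogonal to products of centred functions. -/
theorem PairIdentity.integral_mul_eq_zero (hq : IsBddMeas q) (h : PairIdentity ν K q)
    {k : 𝕏 × 𝕏 → ℝ} (hk : IsAntisymmTest k) {φ ψ : 𝕏 → ℝ} (hφ : IsBddMeas φ)
    (hψ : IsBddMeas ψ) (hφ0 : ∫ x, φ x ∂ν = 0) (hψ0 : ∫ x, ψ x ∂ν = 0) :
    ∫ z, φ z.1 * ψ z.2 * ∫ v, k v * (q v.1 - q v.2) ∂((K z.1).prod (K z.2)) ∂(ν.prod ν) = 0 := by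
  have hkb := hk.toIsBddMeas
  have hc := hkb.mul (hq.fst.mul ((IsBddMeas.const 1).sub hq).snd)
  set C : 𝕏 → ℝ := fun z => ∫ v, k v * (q v.1 * (1 - q v.2)) ∂(K z ⊗ₘ K) with hC
  have hCb : IsBddMeas C := by
    have h1 : C = fun z => ∫ x, ∫ y, k (x, y) * (q x * (1 - q y)) ∂(K x) ∂(K z) := by
      ext z
      rw [hC, ← hc.integral_compProd]
    rw [h1]
    exact (hc.integral_kernel K).snd.integral_kernel K
  have h2 : ∫ z, φ z.1 * ψ z.2 * ∫ v, k v * (q v.1 - q v.2) ∂((K z.1).prod (K z.2)) ∂(ν.prod ν)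
      = ∫ z, ((φ z.1 * C z.1) * ψ z.2 + φ z.1 * (ψ z.2 * C z.2)) ∂(ν.prod ν) := by
    refine integral_congr_ae ?_
    filter_upwards [h] with z hz
    rw [hz k hk]
    ring
  have i1 := ((hφ.mul hCb).fst.mul hψ.snd).integrable (ν.prod ν)
  have i2 := (hφ.fst.mul (hψ.mul hCb).snd).integrable (ν.prod ν)
  have e1 := integral_prod_mul (μ := ν) (ν := ν) (fun x => φ x * C x) ψ
  have e2 := integral_prod_mul (μ := ν) (ν := ν) φ (fun x => ψ x * C x)
  rw [h2, integral_add i1 i2, e1, e2, hφ0, hψ0]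
  ring

/-- The symmetrised indicator of `S ×ˢ T`. -/
noncomputable def symmIndicator (S T : Set 𝕏) (v : 𝕏 × 𝕏) : ℝ :=
  S.indicator (fun _ => (1 : ℝ)) v.1 * T.indicator (fun _ => (1 : ℝ)) v.2
    + T.indicator (fun _ => (1 : ℝ)) v.1 * S.indicator (fun _ => (1 : ℝ)) v.2

theorem isBddMeas_symmIndicator {S T : Set 𝕏} (hS : MeasurableSet S) (hT : MeasurableSet T) :
    IsBddMeas (symmIndicator S T) :=
  ((IsBddMeas.indicator_one hS).fst.mul (IsBddMeas.indicator_one hT).snd).add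
    ((IsBddMeas.indicator_one hT).fst.mul (IsBddMeas.indicator_one hS).snd)

theorem integral_symmIndicator {S T : Set 𝕏} (hS : MeasurableSet S) (hT : MeasurableSet T)
    (μ ρ : Measure 𝕏) [IsFiniteMeasure μ] [IsFiniteMeasure ρ] :
    ∫ v, symmIndicator S T v ∂(μ.prod ρ) = μ.real S * ρ.real T + μ.real T * ρ.real S := by
  have hi : ∀ (S : Set 𝕏) (hS : MeasurableSet S) (ρ : Measure 𝕏),
      ∫ y, S.indicator (fun _ => (1 : ℝ)) y ∂ρ = ρ.real S := fun S hS ρ => by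
    rw [integral_indicator hS, setIntegral_one_eq_measureReal]
  have e1 := integral_prod_mul (μ := μ) (ν := ρ) (S.indicator fun _ => (1 : ℝ))
    (T.indicator fun _ => (1 : ℝ))
  have e2 := integral_prod_mul (μ := μ) (ν := ρ) (T.indicator fun _ => (1 : ℝ))
    (S.indicator fun _ => (1 : ℝ))
  simp only [symmIndicator]
  rw [integral_add
    (((IsBddMeas.indicator_one hS).fst.mul (IsBddMeas.indicator_one hT).snd).integrable _)
    (((IsBddMeas.indicator_one hT).fst.mul (IsBddMeas.indicator_one hS).snd).integrable _),
    e1, e2, hi S hS, hi T hT, hi S hS, hi T hT]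

/-- The ideal test function is the symmetrised indicator divided by `q v.1 - q v.2`: it is
antisymmetric, and the factor `q v.1 - q v.2` cancels. It may be unbounded, so it is reached as a
limit. -/
theorem PairIdentity.integral_symmIndicator_eq_zero (hq : IsBddMeas q) (h : PairIdentity ν K q)
    {S T : Set 𝕏} (hS : MeasurableSet S) (hT : MeasurableSet T)
    (hST : ∀ x ∈ S, ∀ y ∈ T, q x ≠ q y) {φ ψ : 𝕏 → ℝ} (hφ : IsBddMeas φ)
    (hψ : IsBddMeas ψ) (hφ0 : ∫ x, φ x ∂ν = 0) (hψ0 : ∫ x, ψ x ∂ν = 0) :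
    (∫ x, φ x * (K x).real S ∂ν) * (∫ x, ψ x * (K x).real T ∂ν)
      + (∫ x, φ x * (K x).real T ∂ν) * (∫ x, ψ x * (K x).real S ∂ν) = 0 := by
  have hs := isBddMeas_symmIndicator hS hT
  have hqd : IsBddMeas fun v : 𝕏 × 𝕏 => q v.1 - q v.2 := hq.fst.sub hq.snd
  set d : 𝕏 × 𝕏 → ℝ := fun v => q v.1 - q v.2 with hd
  -- A bounded odd regularisation of `1 / t`: `u n t * t` lies in `[0, 1]` and tends to `1` for `t ≠
  -- 0`.
  let u : ℕ → ℝ → ℝ := fun n t => n * t / (1 + n * t ^ 2)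
  have hden : ∀ (n : ℕ) (t : ℝ), 0 < 1 + n * t ^ 2 := fun n t => by positivity
  have hu : ∀ n, IsBddMeas fun v => u n (d v) := by
    intro n
    have h1 : IsBddMeas fun v => (1 + (n : ℝ) * d v ^ 2)⁻¹ :=
      .of_mem_Icc (by have := hqd.measurable; fun_prop) (fun v => by positivity)
        fun v => inv_le_one_of_one_le₀ (by nlinarith [sq_nonneg (d v), (Nat.cast_nonneg n : (0:ℝ) ≤ n)])
    simpa only [u, div_eq_mul_inv] using ((IsBddMeas.const (n : ℝ)).mul hqd).mul h1
  have hk : ∀ n, IsAntisymmTest fun v => symmIndicator S T v * u n (d v) := fun n =>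
    ⟨hs.mul (hu n), fun v => by
      simp only [symmIndicator, Prod.fst_swap, Prod.snd_swap, u, hd]
      rw [show (q v.2 - q v.1) ^ 2 = (q v.1 - q v.2) ^ 2 by ring]
      ring⟩
  let Λ := (ν.prod ν) ⊗ₘ (K ∥ₖ K)
  let F : ℕ → (𝕏 × 𝕏) × (𝕏 × 𝕏) → ℝ := fun n w =>
    φ w.1.1 * ψ w.1.2 * (symmIndicator S T w.2 * u n (d w.2) * d w.2)
  have hφψ : IsBddMeas fun z : 𝕏 × 𝕏 => φ z.1 * ψ z.2 := hφ.fst.mul hψ.snd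
  have hFb : ∀ n, IsBddMeas (F n) := fun n => hφψ.fst.mul (((hs.mul (hu n)).mul hqd).snd)
  have hGb : IsBddMeas fun w : (𝕏 × 𝕏) × (𝕏 × 𝕏) =>
    φ w.1.1 * ψ w.1.2 * symmIndicator S T w.2 := hφψ.fst.mul hs.snd
  have hF0 : ∀ n, ∫ w, F n w ∂Λ = 0 := by
    intro n
    rw [(hFb n).integral_compProd, ← h.integral_mul_eq_zero hq (hk n) hφ hψ hφ0 hψ0]
    refine integral_congr_ae (.of_forall fun z => ?_)
    simp only [F, Kernel.parallelComp_apply]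
    rw [integral_const_mul]
  have hlim : Filter.Tendsto (fun n => ∫ w, F n w ∂Λ) Filter.atTop
      (nhds (∫ w, φ w.1.1 * ψ w.1.2 * symmIndicator S T w.2 ∂Λ)) := by
    refine tendsto_integral_of_dominated_convergence
      (fun w => |φ w.1.1 * ψ w.1.2 * symmIndicator S T w.2|)
      (fun n => (hFb n).measurable.aestronglyMeasurable) (hGb.integrable Λ).abs
      (fun n => .of_forall fun w => ?_) (.of_forall fun w => ?_)
    · have e1 : F n w = φ w.1.1 * ψ w.1.2 * symmIndicator S T w.2 * (u n (d w.2) * d w.2) := by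
        simp only [F]
        ring
      have e2 : |u n (d w.2) * d w.2| ≤ 1 := by
        have e3 : u n (d w.2) * d w.2 = n * d w.2 ^ 2 / (1 + n * d w.2 ^ 2) := by
          simp only [u]
          ring
        rw [e3, abs_of_nonneg (by positivity), div_le_one (hden _ _)]
        linarith
      rw [e1, Real.norm_eq_abs, abs_mul]
      exact mul_le_of_le_one_right (abs_nonneg _) e2
    · by_cases hw : symmIndicator S T w.2 = 0
      · simp [F, hw]
      · have hdw : d w.2 ≠ 0 := by
          intro h0
          apply hw
          have hne : ∀ x y, q x - q y = 0 → S.indicator (fun _ => (1 : ℝ)) x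
              * T.indicator (fun _ => (1 : ℝ)) y = 0 := by
            intro x y hxy
            by_cases hx : x ∈ S
            · by_cases hy : y ∈ T
              · exact absurd (sub_eq_zero.1 hxy) (hST x hx y hy)
              · simp [hy]
            · simp [hx]
          simp only [symmIndicator]
          rw [hne _ _ h0, mul_comm, hne _ _ (by simp only [hd] at h0; linarith), add_zero]
        have e1 : ∀ n, F n w = φ w.1.1 * ψ w.1.2 * symmIndicator S T w.2
            * (1 - 1 / (1 + n * d w.2 ^ 2)) := fun n => by
          have := (hden n (d w.2)).ne'
          simp only [F, u]
          field_simp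
          ring
        simp only [e1]
        conv => rhs; rw [← mul_one (_ * symmIndicator S T w.2), ← sub_zero (1 : ℝ)]
        refine Filter.Tendsto.const_mul _ (Filter.Tendsto.const_sub _ ?_)
        refine Filter.Tendsto.div_atTop tendsto_const_nhds ?_
        exact Filter.tendsto_atTop_add_const_left _ _
          (tendsto_natCast_atTop_atTop.atTop_mul_const (by positivity))
  simp only [hF0] at hlim
  have h0 := tendsto_nhds_unique hlim tendsto_const_nhds
  rw [hGb.integral_compProd] at h0
  have hreal : ∀ {S : Set 𝕏}, MeasurableSet S → IsBddMeas fun x => (K x).real S := fun hS =>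
    .of_mem_Icc (K.measurable_coe hS).ennreal_toReal (fun _ => measureReal_nonneg)
      fun _ => measureReal_le_one
  have e1 := integral_prod_mul (μ := ν) (ν := ν) (fun x => φ x * (K x).real S)
    (fun x => ψ x * (K x).real T)
  have e2 := integral_prod_mul (μ := ν) (ν := ν) (fun x => φ x * (K x).real T)
    (fun x => ψ x * (K x).real S)
  rw [← e1, ← e2, ← integral_add
    (((hφ.mul (hreal hS)).fst.mul (hψ.mul (hreal hT)).snd).integrable _)
    (((hφ.mul (hreal hT)).fst.mul (hψ.mul (hreal hS)).snd).integrable _), ← h0]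
  refine integral_congr_ae (.of_forall fun z => ?_)
  simp only [Kernel.parallelComp_apply]
  rw [integral_const_mul, integral_symmIndicator hS hT]
  ring

theorem integral_pos_of_ae_pos {ν : Measure 𝕏} [NeZero ν] (hpos : ∀ᵐ x ∂ν, 0 < q x) (hint : Integrable q ν) :
    0 < ∫ x, q x ∂ν := by
  refine (integral_nonneg_of_ae (hpos.mono fun _ h => h.le)).lt_of_ne' fun h0 => ?_
  rw [integral_eq_zero_iff_of_nonneg_ae (hpos.mono fun _ h => h.le) hint] at h0
  obtain ⟨x, hx, hx'⟩ := (h0.and hpos).exists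
  exact hx'.ne' hx

/-- Let `V_S`, `V_T` and `C` be the variances and the covariance of `K z S` and `K z T` under `ν`.
Testing with the centred versions gives `2 V_S C = 0` and `V_S V_T + C² = 0`, so one variance
vanishes. The constant value is then identified by the `q`-weighted mean. -/
theorem PairIdentity.ae_eq_or_ae_eq (hq : IsBddMeas q) (hqpos : ∀ᵐ x ∂ν, 0 < q x)
    (h1 : UrnIdentity K q ν) (h : PairIdentity ν K q)
    {S T : Set 𝕏} (hS : MeasurableSet S) (hT : MeasurableSet T)
    (hST : ∀ x ∈ S, ∀ y ∈ T, q x ≠ q y) :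
    (∀ᵐ z ∂ν, K z S = ν S) ∨ (∀ᵐ z ∂ν, K z T = ν T) := by
  have hreal : ∀ {S : Set 𝕏}, MeasurableSet S → IsBddMeas fun x => (K x).real S := fun hS =>
    .of_mem_Icc (K.measurable_coe hS).ennreal_toReal (fun _ => measureReal_nonneg)
      fun _ => measureReal_le_one
  let u : Set 𝕏 → 𝕏 → ℝ := fun S x => (K x).real S - ∫ y, (K y).real S ∂ν
  have hu : ∀ {S}, MeasurableSet S → IsBddMeas (u S) := fun hS => (hreal hS).sub (.const _)
  have hu0 : ∀ {S}, MeasurableSet S → ∫ x, u S x ∂ν = 0 := fun hS => by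
    simp only [u]
    rw [integral_sub ((hreal hS).integrable ν) (integrable_const _)]
    simp
  have huK : ∀ {S T}, MeasurableSet S → MeasurableSet T →
      ∫ x, u S x * (K x).real T ∂ν = ∫ x, u S x * u T x ∂ν := by
    intro S T hS hT
    have : ∀ x, u S x * u T x = u S x * (K x).real T - u S x * ∫ y, (K y).real T ∂ν := fun x => by
      simp only [u]
      ring
    simp only [this]
    rw [integral_sub (((hu hS).mul (hreal hT)).integrable _)
      (((hu hS).mul (.const _)).integrable _), integral_mul_const, hu0 hS]
    ring
  have hcomm : ∫ x, u T x * u S x ∂ν = ∫ x, u S x * u T x ∂ν :=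
    integral_congr_ae (.of_forall fun x => mul_comm _ _)
  have hfin : ∀ {S}, MeasurableSet S → ∫ x, u S x * u S x ∂ν = 0 → ∀ᵐ z ∂ν, K z S = ν S := by
    intro S hS h0
    rw [integral_eq_zero_iff_of_nonneg (fun x => mul_self_nonneg _)
      (((hu hS).mul (hu hS)).integrable _)] at h0
    have h2 := h1.integral_mul_integral_kernel hq (IsBddMeas.indicator_one hS)
    have hi : ∀ ρ : Measure 𝕏, ∫ y, S.indicator (fun _ => (1 : ℝ)) y ∂ρ = ρ.real S := fun ρ => by
      rw [integral_indicator hS, setIntegral_one_eq_measureReal]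
    simp only [hi] at h2
    have h3 : ∫ x, q x * (K x).real S ∂ν = ∫ x, q x * (∫ y, (K y).real S ∂ν) ∂ν := by
      refine integral_congr_ae ?_
      filter_upwards [h0] with x hx
      have : (K x).real S = ∫ y, (K y).real S ∂ν := by simpa [u, sub_eq_zero] using hx
      rw [← this]
    have hqint : 0 < ∫ x, q x ∂ν := integral_pos_of_ae_pos hqpos (hq.integrable _)
    rw [h3, integral_mul_const] at h2
    have h4 := mul_left_cancel₀ hqint.ne' h2
    filter_upwards [h0] with x hx
    have : (K x).real S = ∫ y, (K y).real S ∂ν := by simpa [u, sub_eq_zero] using hx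
    rw [h4] at this
    exact (measureReal_eq_measureReal_iff).1 this
  have k1 := h.integral_symmIndicator_eq_zero hq hS hT hST (hu hS) (hu hS) (hu0 hS) (hu0 hS)
  have k2 := h.integral_symmIndicator_eq_zero hq hS hT hST (hu hS) (hu hT) (hu0 hS) (hu0 hT)
  rw [huK hS hS, huK hS hT] at k1
  rw [huK hS hS, huK hS hT, huK hT hS, huK hT hT, hcomm] at k2
  by_cases ha : ∫ x, u S x * u S x ∂ν = 0
  · exact .inl (hfin hS ha)
  · have hc : ∫ x, u S x * u T x ∂ν = 0 := by
      have : (∫ x, u S x * u S x ∂ν) * ∫ x, u S x * u T x ∂ν = 0 := by linarith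
      exact (mul_eq_zero.1 this).resolve_left ha
    rw [hc, mul_zero, add_zero] at k2
    exact .inr (hfin hT ((mul_eq_zero.1 k2).resolve_left ha))

end Separation

/-! ### Reversibility and idempotence of `K`. -/

section Core

variable {𝕏 : Type*} [MeasurableSpace 𝕏] [MeasurableSpace.CountablyGenerated 𝕏]
  {ν : Measure 𝕏} [IsProbabilityMeasure ν]
  {K : Kernel 𝕏 𝕏} [IsMarkovKernel K] {f : 𝕏 → ℝ≥0} {q : 𝕏 → ℝ}

omit [IsProbabilityMeasure ν] in
theorem ae_measure_eq_of_forall_ae_apply_eq {μ : 𝕏 → Measure 𝕏} {ρ : Measure 𝕏}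
    [∀ x, IsFiniteMeasure (μ x)] {p : 𝕏 → Prop}
    (h : ∀ S, MeasurableSet S → ∀ᵐ x ∂ν, p x → μ x S = ρ S) : ∀ᵐ x ∂ν, p x → μ x = ρ := by
  obtain ⟨B, hBm, hBpi, hBgen⟩ := MeasurableSpace.exists_seq_isPiSystem_generateFrom 𝕏
  filter_upwards [ae_all_iff.2 fun n => h (B n) (hBm n), h Set.univ .univ] with x hx hu hp
  refine ext_of_generate_finite _ hBgen hBpi ?_ (hu hp)
  rintro _ ⟨n, rfl⟩
  exact hx n hp

/-- A bootstrap from `B = Aᶜ` to the whole space: first `K z = ν` as measures on `B`, then `K w = ν`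
everywhere for `w ∈ B`, and finally the pair identity between `z` and such a `w` gives `K z = ν`. -/
theorem PairIdentity.ae_eq_of_forall_subset_compl (hq : IsBddMeas q) (hq1 : ∀ x, q x < 1)
    (hqpos : ∀ᵐ x ∂ν, 0 < q x) (h1 : UrnIdentity K q ν) (h : PairIdentity ν K q)
    {A : Set 𝕏} (hA : MeasurableSet A) (hAc : ν Aᶜ ≠ 0)
    (hgood : ∀ T, MeasurableSet T → T ⊆ Aᶜ → ∀ᵐ z ∂ν, K z T = ν T) :
    ∀ᵐ z ∂ν, K z = ν := by
  have hBm := hA.compl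
  set B := Aᶜ with hB
  have hpb : IsBddMeas fun x => 1 - q x := (IsBddMeas.const 1).sub hq
  have hBb := IsBddMeas.indicator_one hBm
  -- on `B` every `K z` agrees with `ν`
  have hres : ∀ᵐ z ∂ν, (K z).restrict B = ν.restrict B := by
    have := ae_measure_eq_of_forall_ae_apply_eq (ν := ν) (μ := fun z => (K z).restrict B)
      (ρ := ν.restrict B) (p := fun _ => True) fun S hS => by
        filter_upwards [hgood (S ∩ B) (hS.inter hBm) Set.inter_subset_right] with z hz _
        rw [Measure.restrict_apply hS, Measure.restrict_apply hS, hz]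
    exact this.mono fun z hz => hz trivial
  have hind : ∀ (S : Set 𝕏), MeasurableSet S → ∀ (g : 𝕏 → ℝ) (ρ : Measure 𝕏),
      ∫ x, S.indicator (fun _ => (1 : ℝ)) x * g x ∂ρ = ∫ x in S, g x ∂ρ := by
    intro S hS g ρ
    rw [← integral_indicator hS]
    refine integral_congr_ae (.of_forall fun x => ?_)
    by_cases hx : x ∈ S <;> simp [hx]
  have hind1 : ∀ (S : Set 𝕏), MeasurableSet S → ∀ (ρ : Measure 𝕏),
      ∫ x, S.indicator (fun _ => (1 : ℝ)) x ∂ρ = ρ.real S := by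
    intro S hS ρ
    rw [integral_indicator hS, setIntegral_one_eq_measureReal]
  have hreal : ∀ {S : Set 𝕏}, MeasurableSet S → IsBddMeas fun x => (K x).real S := fun hS =>
    .of_mem_Icc (K.measurable_coe hS).ennreal_toReal (fun _ => measureReal_nonneg)
      fun _ => measureReal_le_one
  -- for `x ∈ B`, `K x = ν`
  have hpart : ∀ S, MeasurableSet S → ∀ᵐ x ∂ν, x ∈ B → K x S = ν S := by
    intro S hS
    have hSb := IsBddMeas.indicator_one hS
    set e : 𝕏 → ℝ := fun x => (K x).real S - ν.real S with he
    have heb : IsBddMeas e := (hreal hS).sub (.const _)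
    have hψ : IsBddMeas fun x => B.indicator (fun _ => (1 : ℝ)) x * e x := hBb.mul heb
    -- Every `K x` integrates functions supported in `B` as `ν` does, so one term on each side
    -- cancels and `∫ q e² = 0` over `B` remains.
    have key := h1.integral_wedge hq hSb hψ
    have e1 : ∫ x, S.indicator (fun _ => (1 : ℝ)) x * q x
        * ∫ y, B.indicator (fun _ => (1 : ℝ)) y * e y ∂(K x) ∂ν
        = (∫ x, S.indicator (fun _ => (1 : ℝ)) x * q x ∂ν)
          * ∫ y, B.indicator (fun _ => (1 : ℝ)) y * e y ∂ν := by
      rw [← integral_mul_const]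
      refine integral_congr_ae ?_
      filter_upwards [hres] with x hx
      rw [hind B hBm, hx, ← hind B hBm]
    rw [e1] at key
    have e2 : ∫ x, B.indicator (fun _ => (1 : ℝ)) x * e x * q x * (K x).real S ∂ν
        = (∫ x, B.indicator (fun _ => (1 : ℝ)) x * e x * q x ∂ν) * ν.real S := by
      simp only [hind1 S hS] at key
      linarith
    rw [← integral_mul_const, ← sub_eq_zero, ← integral_sub
      (((hψ.mul hq).mul (hreal hS)).integrable _)
      (((hψ.mul hq).mul (.const _)).integrable _)] at e2
    have e3 := ae_eq_zero_of_integral_mul_sq_eq_zero (ν := ν) hq hqpos hψ (by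
      rw [← e2]
      refine integral_congr_ae (.of_forall fun x => ?_)
      by_cases hx : x ∈ B
      · simp only [hx, Set.indicator_of_mem, he]
        ring
      · simp [hx])
    filter_upwards [e3] with x hx hxB
    rw [Set.indicator_of_mem hxB, one_mul, sub_eq_zero] at hx
    exact (measureReal_eq_measureReal_iff).1 hx
  have hKB : ∀ᵐ x ∂ν, x ∈ B → K x = ν := ae_measure_eq_of_forall_ae_apply_eq hpart
  set good : 𝕏 → Prop := fun x => (K x).restrict B = ν.restrict B ∧ (x ∈ B → K x = ν) with hgooddef
  have hgood' : ∀ᵐ x ∂ν, good x := hres.and hKB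
  have hQB : 0 < ∫ x in B, q x ∂ν := by
    have : NeZero (ν.restrict B) := ⟨by rwa [Ne, Measure.restrict_eq_zero]⟩
    exact integral_pos_of_ae_pos (ae_restrict_of_ae hqpos) (hq.integrable _)
  filter_upwards [hgood', h1.ae_ae_kernel hq hqpos hgood', Measure.ae_ae_of_ae_prod h]
    with z hz hKz hpair
  -- Such a `w` exists because `ν B ≠ 0`.
  obtain ⟨w, hwB, hw, hwpair⟩ : ∃ w ∈ B, good w ∧ ∀ k, IsAntisymmTest k →
      ∫ v, k v * (q v.1 - q v.2) ∂((K z).prod (K w))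
        = ∫ v, k v * (q v.1 * (1 - q v.2)) ∂(K z ⊗ₘ K)
          + ∫ v, k v * (q v.1 * (1 - q v.2)) ∂(K w ⊗ₘ K) := by
    by_contra hno
    push Not at hno
    apply hAc
    refine measure_eq_zero_iff_ae_notMem.2 ?_
    filter_upwards [hgood', hpair] with w hw1 hw2 hwB
    obtain ⟨k, hk, hk'⟩ := hno w hwB hw1
    exact hk' (hw2 k hk)
  rw [hw.2 hwB] at hwpair
  have hsmall : ∀ S, MeasurableSet S → S ⊆ A →
      ∫ x in S, (1 - q x) ∂(K z) = ∫ x in S, (1 - q x) ∂ν := by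
    intro S hS hSA
    have hSb := IsBddMeas.indicator_one hS
    have hC : ∀ ρ : Measure 𝕏, IsProbabilityMeasure ρ → (∀ᵐ x ∂ρ, good x) →
        ∫ v, (S.indicator (fun _ => (1 : ℝ)) v.1 * B.indicator (fun _ => (1 : ℝ)) v.2
          - B.indicator (fun _ => (1 : ℝ)) v.1 * S.indicator (fun _ => (1 : ℝ)) v.2)
            * (q v.1 * (1 - q v.2)) ∂(ρ ⊗ₘ K)
          = (∫ x in S, q x ∂ρ) * (∫ x in B, (1 - q x) ∂ν)
            - (∫ x in B, q x ∂ρ) * ∫ x in S, (1 - q x) ∂ν := by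
      intro ρ hρ hgρ
      have hb1 := (hSb.fst.mul hBb.snd).mul (hq.fst.mul hpb.snd)
      have hb2 := (hBb.fst.mul hSb.snd).mul (hq.fst.mul hpb.snd)
      simp only [sub_mul]
      rw [integral_sub (hb1.integrable _) (hb2.integrable _), hb1.integral_compProd,
        hb2.integral_compProd, ← hind S hS q, ← hind B hBm q, ← integral_mul_const,
        ← integral_mul_const]
      have hpull : ∀ (T T' : Set 𝕏), MeasurableSet T → MeasurableSet T' → ∀ x,
          ∫ y, T.indicator (fun _ => (1 : ℝ)) x * T'.indicator (fun _ => (1 : ℝ)) y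
            * (q x * (1 - q y)) ∂(K x)
          = T.indicator (fun _ => (1 : ℝ)) x * q x * ∫ y in T', (1 - q y) ∂(K x) := by
        intro T T' _ hT' x
        rw [← hind T' hT', ← integral_const_mul]
        refine integral_congr_ae (.of_forall fun y => ?_)
        ring
      congr 1
      · refine integral_congr_ae ?_
        filter_upwards [hgρ] with x hx
        rw [hpull S B hS hBm, hx.1]
      · refine integral_congr_ae ?_
        filter_upwards [hgρ] with x hx
        rw [hpull B S hBm hS]
        by_cases hxB : x ∈ B
        · rw [hx.2 hxB]
        · simp [hxB]
    -- With `K w = ν` and agreement on `B`, this test leaves the claim multiplied by `∫ q` over `B`,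
    -- which is positive.
    have key := hwpair _ (.wedge hSb hBb)
    rw [hC _ inferInstance hKz, hC _ inferInstance hgood', hz.1] at key
    have hlhs : ∫ v, (S.indicator (fun _ => (1 : ℝ)) v.1 * B.indicator (fun _ => (1 : ℝ)) v.2
          - B.indicator (fun _ => (1 : ℝ)) v.1 * S.indicator (fun _ => (1 : ℝ)) v.2)
            * (q v.1 - q v.2) ∂((K z).prod ν)
        = (∫ x in S, q x ∂(K z)) * ν.real B - (K z).real S * (∫ x in B, q x ∂ν)
          - ((∫ x in B, q x ∂ν) * ν.real S - ν.real B * ∫ x in S, q x ∂ν) := by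
      have hzB : (K z).real B = ν.real B := by
        have := congrArg (fun m => m.real Set.univ) hz.1
        simpa using this
      have e1 := integral_prod_mul (μ := K z) (ν := ν)
        (fun x => S.indicator (fun _ => (1 : ℝ)) x * q x) (B.indicator fun _ => (1 : ℝ))
      have e2 := integral_prod_mul (μ := K z) (ν := ν)
        (S.indicator fun _ => (1 : ℝ)) (fun x => B.indicator (fun _ => (1 : ℝ)) x * q x)
      have e3 := integral_prod_mul (μ := K z) (ν := ν)
        (fun x => B.indicator (fun _ => (1 : ℝ)) x * q x) (S.indicator fun _ => (1 : ℝ))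
      have e4 := integral_prod_mul (μ := K z) (ν := ν)
        (B.indicator fun _ => (1 : ℝ)) (fun x => S.indicator (fun _ => (1 : ℝ)) x * q x)
      rw [hind S hS, hind1 B hBm] at e1
      rw [hind B hBm, hind1 S hS] at e2
      rw [hind B hBm, hind1 S hS, hz.1] at e3
      rw [hind S hS, hind1 B hBm, hzB] at e4
      have i1 := (((hSb.mul hq).fst.mul hBb.snd)).integrable ((K z).prod ν)
      have i2 := ((hSb.fst.mul (hBb.mul hq).snd)).integrable ((K z).prod ν)
      have i3 := (((hBb.mul hq).fst.mul hSb.snd)).integrable ((K z).prod ν)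
      have i4 := ((hBb.fst.mul (hSb.mul hq).snd)).integrable ((K z).prod ν)
      have i12 := integral_sub i1 i2
      have i34 := integral_sub i3 i4
      have i1234 := integral_sub (i1.sub i2) (i3.sub i4)
      simp only [Pi.sub_apply] at i1234
      rw [i12, i34, e1, e2, e3, e4] at i1234
      rw [← i1234]
      refine integral_congr_ae (.of_forall fun v => ?_)
      ring
    rw [hlhs] at key
    have hp : ∀ (T : Set 𝕏) (ρ : Measure 𝕏), IsFiniteMeasure ρ →
        ∫ x in T, (1 - q x) ∂ρ = ρ.real T - ∫ x in T, q x ∂ρ := by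
      intro T ρ _
      rw [integral_sub (integrable_const _) (hq.integrable _), setIntegral_one_eq_measureReal]
    rw [hp B ν inferInstance, hp S ν inferInstance] at key
    rw [hp S ν inferInstance, hp S (K z) inferInstance]
    refine mul_left_cancel₀ hQB.ne' ?_
    linarith
  -- The two measures agree after weighting by `1 - q`, which is positive everywhere and can be
  -- divided out.
  have hall : (K z).withDensity (fun x => ENNReal.ofReal (1 - q x))
      = ν.withDensity fun x => ENNReal.ofReal (1 - q x) := by
    ext S hS
    rw [withDensity_apply _ hS, withDensity_apply _ hS,
      ← ofReal_integral_eq_lintegral_ofReal (hpb.integrable _)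
        (.of_forall fun x => by simpa using (hq1 x).le),
      ← ofReal_integral_eq_lintegral_ofReal (hpb.integrable _)
        (.of_forall fun x => by simpa using (hq1 x).le)]
    congr 1
    have hsplit : ∀ ρ : Measure 𝕏, IsFiniteMeasure ρ → ∫ x in S, (1 - q x) ∂ρ
        = ∫ x in S ∩ A, (1 - q x) ∂ρ + ∫ x in S ∩ B, (1 - q x) ∂ρ := fun ρ _ => by
      rw [hB, ← Set.sdiff_eq, integral_inter_add_sdiff hA (hpb.integrable _)]
    have hSB : ∀ ρ : Measure 𝕏, ρ.restrict (S ∩ B) = (ρ.restrict B).restrict S := fun ρ =>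
      (Measure.restrict_restrict hS).symm
    rw [hsplit _ inferInstance, hsplit ν inferInstance,
      hsmall (S ∩ A) (hS.inter hA) Set.inter_subset_right, hSB, hSB, hz.1]
  have hpm : Measurable fun x => ENNReal.ofReal (1 - q x) := hpb.measurable.ennreal_ofReal
  have hinv : ∀ ρ : Measure 𝕏, (ρ.withDensity fun x => ENNReal.ofReal (1 - q x)).withDensity
      (fun x => (ENNReal.ofReal (1 - q x)))⁻¹ = ρ := fun ρ =>
    withDensity_inv_same hpm (.of_forall fun x => by simpa using hq1 x)
      (.of_forall fun x => ENNReal.ofReal_ne_top)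
  rw [← hinv (K z), hall, hinv]

/-- Either `K z` and `ν` agree a.e. on each measurable subset of `Aᶜ`, or some bad `T ⊆ Aᶜ` forces,
by the dichotomy for separated sets, agreement on each measurable subset of `A`. The bootstrap
applies from whichever side is good. -/
theorem PairIdentity.ae_eq_of_separating (hq : IsBddMeas q) (hq1 : ∀ x, q x < 1)
    (hqpos : ∀ᵐ x ∂ν, 0 < q x) (h1 : UrnIdentity K q ν) (h : PairIdentity ν K q)
    {A : Set 𝕏} (hA : MeasurableSet A) (hsep : ∀ x ∈ A, ∀ y ∈ Aᶜ, q x ≠ q y)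
    (hA0 : ν A ≠ 0) (hAc : ν Aᶜ ≠ 0) : ∀ᵐ z ∂ν, K z = ν := by
  by_cases hT : ∀ T, MeasurableSet T → T ⊆ Aᶜ → ∀ᵐ z ∂ν, K z T = ν T
  · exact h.ae_eq_of_forall_subset_compl hq hq1 hqpos h1 hA hAc hT
  · push Not at hT
    obtain ⟨T, hTm, hTA, hT⟩ := hT
    refine h.ae_eq_of_forall_subset_compl hq hq1 hqpos h1 hA.compl (by rwa [compl_compl])
      fun S hS hSA => ?_
    rw [compl_compl] at hSA
    exact (h.ae_eq_or_ae_eq hq hqpos h1 hS hTm fun x hx y hy =>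
      hsep x (hSA hx) y (hTA hy)).resolve_right (by simpa using hT)

omit [MeasurableSpace.CountablyGenerated 𝕏] in
theorem reversible_idempotent_of_ae_eq (h : ∀ᵐ z ∂ν, K z = ν) :
    (ν ⊗ₘ K).map Prod.swap = ν ⊗ₘ K ∧ ∀ᵐ z ∂ν, K ∘ₘ (K z) = K z := by
  have h1 : K =ᵐ[ν] Kernel.const 𝕏 ν := h
  refine ⟨?_, ?_⟩
  · rw [Measure.compProd_congr h1, Measure.compProd_const, Measure.prod_swap]
  · filter_upwards [h] with z hz
    rw [hz, Measure.bind_congr_right h1, Measure.const_comp, measure_univ, one_smul]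

-- For constant `q` the right side of the urn identity vanishes by antisymmetry and the left is a
-- positive multiple of `∫ k`, so `μ ⊗ₘ K` is symmetric. Taking `μ = ν` gives reversibility;
-- subtracting this from the case `μ = ν + f z • K z` gives the symmetry of `K z ⊗ₘ K`.
omit [MeasurableSpace.CountablyGenerated 𝕏] in
theorem reversible_idempotent_of_ae_const (hq : IsBddMeas q) (hq1 : ∀ x, q x < 1)
    (hqpos : ∀ᵐ x ∂ν, 0 < q x) (hf : ∀ᵐ x ∂ν, 0 < f x) (h1 : UrnIdentity K q ν)
    (h2 : ∀ᵐ z ∂ν, UrnIdentity K q (ν + f z • K z)) {c : ℝ} (hc : ∀ᵐ x ∂ν, q x = c) :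
    (ν ⊗ₘ K).map Prod.swap = ν ⊗ₘ K ∧ ∀ᵐ z ∂ν, K ∘ₘ (K z) = K z := by
  obtain ⟨x₀, hx₀, hx₀'⟩ := (hc.and hqpos).exists
  have hc0 : 0 < c := hx₀ ▸ hx₀'
  have hc1 : c < 1 := hx₀ ▸ hq1 x₀
  have hcm : MeasurableSet {x | q x = c} := hq.measurable (measurableSet_singleton c)
  have hKc := h1.ae_ae_kernel hq hqpos hc
  -- the test integrals against `μ ⊗ₘ K` vanish when `q` is constant
  have hvan : ∀ μ : Measure 𝕏, IsFiniteMeasure μ → (∀ᵐ x ∂μ, q x = c) →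
      (∀ᵐ x ∂μ, ∀ᵐ y ∂(K x), q y = c) → UrnIdentity K q μ → ∀ k, IsAntisymmTest k →
      ∫ v, k v ∂(μ ⊗ₘ K) = 0 := by
    intro μ _ hμ1 hμ2 hμ k hk
    have key := hμ k hk
    have hfst : ∀ᵐ v ∂(μ ⊗ₘ K), q v.1 = c := Measure.ae_compProd_of_ae_fst K hcm hμ1
    have hsnd : ∀ᵐ v ∂(μ ⊗ₘ K), q v.2 = c :=
      Measure.ae_compProd_of_ae_ae (measurable_snd hcm) hμ2
    have hfst' : ∀ᵐ v ∂(μ.prod μ), q v.1 = c := Measure.quasiMeasurePreserving_fst.ae hμ1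
    have e1 : ∫ v, k v * (q v.1 * (1 - q v.2)) ∂(μ ⊗ₘ K)
        = (∫ v, k v ∂(μ ⊗ₘ K)) * (c * (1 - c)) := by
      rw [← integral_mul_const]
      refine integral_congr_ae ?_
      filter_upwards [hfst, hsnd] with v h h'
      rw [h, h']
    have e2 : ∫ v, k v * (q v.1 * q v.2) ∂(μ ⊗ₘ K) = (∫ v, k v ∂(μ ⊗ₘ K)) * (c * c) := by
      rw [← integral_mul_const]
      refine integral_congr_ae ?_
      filter_upwards [hfst, hsnd] with v h h'
      rw [h, h']
    have e3 : ∫ v, k v * q v.1 ∂(μ.prod μ) = 0 := by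
      have : ∫ v, k v * q v.1 ∂(μ.prod μ) = (∫ v, k v ∂(μ.prod μ)) * c := by
        rw [← integral_mul_const]
        refine integral_congr_ae ?_
        filter_upwards [hfst'] with v h
        rw [h]
      rw [this, integral_eq_zero_of_swap_eq_neg Measure.prod_swap hk.measurable hk.swap, zero_mul]
    rw [e1, e2, e3] at key
    have hm : 0 ≤ μ.real Set.univ := measureReal_nonneg
    have hfac : (∫ v, k v ∂(μ ⊗ₘ K)) * (μ.real Set.univ * (c * (1 - c)) + c * c) = 0 := by
      linarith
    refine (mul_eq_zero.1 hfac).resolve_right (ne_of_gt ?_)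
    have : 0 < 1 - c := by linarith
    positivity
  have hν := hvan ν inferInstance hc hKc h1
  refine ⟨map_swap_eq_of_forall_isAntisymmTest hν, ?_⟩
  filter_upwards [h2, hKc, h1.ae_ae_kernel hq hqpos hKc, hf] with z hz hz1 hz2 hfz
  have hsm : f z • K z = (f z : ENNReal) • K z := rfl
  have hac : f z • K z ≪ K z := by
    rw [hsm]
    exact Measure.smul_absolutelyContinuous
  have hzv := hvan (ν + f z • K z) inferInstance
    (ae_add_measure_iff.2 ⟨hc, hac.ae_le hz1⟩) (ae_add_measure_iff.2 ⟨hKc, hac.ae_le hz2⟩) hz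
  have hKz : ∀ k, IsAntisymmTest k → ∫ v, k v ∂(K z ⊗ₘ K) = 0 := by
    intro k hk
    have e1 := hzv k hk
    rw [hsm, Measure.compProd_add_left, Measure.compProd_smul_left, integral_add_measure
      (hk.toIsBddMeas.integrable _) ((hk.toIsBddMeas.integrable _).smul_measure (by simp)),
      hν k hk, zero_add, integral_smul_measure] at e1
    simpa [hfz.ne'] using e1
  -- The two marginals of the symmetric measure `K z ⊗ₘ K` are `K z` and `K ∘ₘ K z`.
  have hsw := congrArg Measure.snd (map_swap_eq_of_forall_isAntisymmTest hKz)
  rw [Measure.snd_map_swap, Measure.fst_compProd, Measure.snd_compProd] at hsw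
  exact hsw.symm

theorem reversible_idempotent_of_urnIdentity (hq : IsBddMeas q) (hq1 : ∀ x, q x < 1)
    (hqpos : ∀ᵐ x ∂ν, 0 < q x) (hf : ∀ᵐ x ∂ν, 0 < f x) (h1 : UrnIdentity K q ν)
    (h2 : ∀ᵐ z ∂ν, UrnIdentity K q (ν + f z • K z))
    (h3 : ∀ᵐ z ∂(ν.prod ν), UrnIdentity K q (ν + f z.1 • K z.1 + f z.2 • K z.2)) :
    (ν ⊗ₘ K).map Prod.swap = ν ⊗ₘ K ∧ ∀ᵐ z ∂ν, K ∘ₘ (K z) = K z := by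
  -- If the law of `q` takes only the values 0 and 1, then `q` is a.e. constant; otherwise some
  -- preimage `q ⁻¹' U` and its complement both have positive measure.
  by_cases hsep : ∀ U : Set ℝ, MeasurableSet U → (∀ᵐ x ∂ν, q x ∈ U) ∨ (∀ᵐ x ∂ν, q x ∉ U)
  · obtain ⟨c, hc⟩ := Filter.exists_eventuallyEq_const_of_forall_separating MeasurableSet hsep
    exact reversible_idempotent_of_ae_const hq hq1 hqpos hf h1 h2 hc
  · push Not at hsep
    obtain ⟨U, hU, hU1, hU2⟩ := hsep
    have hpair := pairIdentity_of_urnIdentity hq hf h1 h2 h3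
    refine reversible_idempotent_of_ae_eq (hpair.ae_eq_of_separating hq hq1 hqpos h1
      (A := q ⁻¹' U) (hq.measurable hU) (fun x hx y hy hxy => hy ?_) (fun h0 => hU2 ?_)
      fun h0 => hU1 ?_)
    · rw [Set.mem_preimage, ← hxy]
      exact hx
    · exact measure_eq_zero_iff_ae_notMem.1 h0
    · exact Filter.mem_of_superset (mem_ae_iff.2 h0) fun x hx hn => hn hx

end Core

/-! ### Factorisation of `R` and conclusion. -/

/-- A kernel with finite values is a nonnegative function times a Markov kernel. -/
theorem exists_eq_smul_isMarkovKernel {α β : Type*} [MeasurableSpace α] [MeasurableSpace β]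
    (R : Kernel α β) (hR : ∀ x, IsFiniteMeasure (R x)) (ν : Measure β) [IsProbabilityMeasure ν]
    {θ : ℝ≥0} (hθ : 0 < θ) :
    ∃ (f : α → ℝ≥0) (K : Kernel α β), Measurable f ∧ IsMarkovKernel K ∧
      (∀ x, R x = (θ * f x) • K x) ∧
      ∀ x, 0 < R x Set.univ → 0 < f x ∧ K x = (R x Set.univ)⁻¹ • R x := by
  classical
  have hm : Measurable fun x => R x Set.univ := R.measurable_coe .univ
  have hs : MeasurableSet {x | R x Set.univ = 0} := hm (measurableSet_singleton 0)
  have hf : ∀ x, ((θ * (θ⁻¹ * (R x Set.univ).toNNReal) : ℝ≥0) : ENNReal) = R x Set.univ := fun x => by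
    rw [mul_inv_cancel_left₀ hθ.ne', ENNReal.coe_toNNReal (measure_ne_top _ _)]
  -- Where `R x = 0` the Markov kernel takes the default value `ν`; there `f x = 0`, so the product
  -- is unaffected.
  refine ⟨fun x => θ⁻¹ * (R x Set.univ).toNNReal, Kernel.piecewise hs (Kernel.const _ ν) R.normalize,
    hm.ennreal_toNNReal.const_mul _, ⟨fun x => ?_⟩, fun x => ?_, fun x hx => ⟨?_, ?_⟩⟩
  · rw [Kernel.piecewise_apply]
    split_ifs with h
    · rw [Kernel.const_apply]
      infer_instance
    · refine ⟨?_⟩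
      rw [Kernel.normalize_apply, Measure.smul_apply, smul_eq_mul,
        ENNReal.inv_mul_cancel h (measure_ne_top _ _)]
  · change R x = ((θ * (θ⁻¹ * (R x Set.univ).toNNReal) : ℝ≥0) : ENNReal) • _
    rw [hf, Kernel.piecewise_apply]
    split_ifs with h
    · rw [h, zero_smul]
      exact Measure.measure_univ_eq_zero.1 h
    · rw [Kernel.normalize_apply, smul_smul, ENNReal.mul_inv_cancel h (measure_ne_top _ _),
        one_smul]
  · exact mul_pos (inv_pos.2 hθ) (ENNReal.toNNReal_pos hx.ne' (measure_ne_top _ _))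
  · rw [Kernel.piecewise_apply, if_neg (by exact hx.ne'), Kernel.normalize_apply]

theorem mainTheorem1 {Ω 𝕏 : Type*} [MeasurableSpace Ω]
    [TopologicalSpace 𝕏] [PolishSpace 𝕏] [m𝕏 : MeasurableSpace 𝕏] [BorelSpace 𝕏]
    (P : Measure Ω) [IsProbabilityMeasure P] (X : ℕ → Ω → 𝕏)
    (θ : ℝ) (hθ : 0 < θ) (ν : Measure 𝕏) [IsProbabilityMeasure ν]
    (R : Kernel 𝕏 𝕏) (hRfin : ∀ x, IsFiniteMeasure (R x))
    (hRpos : ∀ᵐ x ∂ν, 0 < R x Set.univ)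
    (hX : IsMVPS P X θ ν R) (hexch : IsExchangeable P X) :
    ∃ 𝒢 : MeasurableSpace 𝕏, 𝒢 ≤ m𝕏 ∧
      (∀ᵐ x ∂ν, (R x Set.univ)⁻¹ • R x = condExpKernel (mΩ := m𝕏) ν 𝒢 x) ∧
      IsCountablyGeneratedUnder (m𝕏 := m𝕏) ν 𝒢 ∧
      IsAEProper (m𝕏 := m𝕏) ν (fun x => condExpKernel (mΩ := m𝕏) ν 𝒢 x) 𝒢 := by
  lift θ to ℝ≥0 using hθ.le
  have hθ' : 0 < θ := by exact_mod_cast hθ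
  obtain ⟨f, K, hf, hK, hRK, hfK⟩ := exists_eq_smul_isMarkovKernel R hRfin ν hθ'
  have hfpos : ∀ᵐ x ∂ν, 0 < f x := hRpos.mono fun x hx => (hfK x hx).1
  -- A bounded substitute for `f`, which need not be bounded or integrable.
  set q : 𝕏 → ℝ := fun x => f x / (1 + f x) with hq
  have hqm : Measurable q := by fun_prop
  have hq1 : ∀ x, q x < 1 := fun x => by
    rw [hq]
    exact (div_lt_one (by positivity)).2 (by linarith)
  have hqb : IsBddMeas q := .of_mem_Icc hqm (fun x => by positivity) fun x => (hq1 x).le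
  have hqpos : ∀ᵐ x ∂ν, 0 < q x := hfpos.mono fun x hx => by positivity
  have hne : ∀ μ : Measure 𝕏, ν + μ ≠ 0 := fun μ h0 => by
    have := congrArg (fun m => m Set.univ) h0
    simp at this
  have h1 : UrnIdentity K q ν :=
    urnIdentity_of_twoDraws_map_swap hf hθ' hRK (by simpa using hne 0)
      (hX.twoDraws_zero_map_swap hθ' hRfin hexch)
  have h2 : ∀ᵐ z ∂ν, UrnIdentity K q (ν + f z • K z) := by
    filter_upwards [hX.ae_twoDraws_one_map_swap hθ' hRfin hexch] with z hz
    refine urnIdentity_of_twoDraws_map_swap hf hθ' hRK (hne _) ?_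
    rwa [smul_add, smul_smul, ← hRK]
  have h3 : ∀ᵐ z ∂(ν.prod ν), UrnIdentity K q (ν + f z.1 • K z.1 + f z.2 • K z.2) := by
    filter_upwards [hX.ae_twoDraws_two_map_swap hθ' hRfin hexch] with z hz
    refine urnIdentity_of_twoDraws_map_swap hf hθ' hRK (by rw [add_assoc]; exact hne _) ?_
    rwa [smul_add, smul_add, smul_smul, smul_smul, ← hRK, ← hRK]
  obtain ⟨hrev, hidem⟩ := reversible_idempotent_of_urnIdentity hqb hq1 hqpos hfpos h1 h2 h3
  obtain ⟨𝒢, h𝒢, hcond, hcg, hproper⟩ :=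
    exists_sigmaAlgebra_of_reversible_idempotent ν K hrev hidem
  refine ⟨𝒢, h𝒢, ?_, hcg, hproper⟩
  filter_upwards [hcond, hRpos] with x hx hRx
  rw [← (hfK x hRx).2, hx]
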